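/- Let $d\ge 0$. Let $\mathsf{C}(d)=\mathsf{Cliff}(d)\rtimes \mathsf{S}(d)$ be the Sergeev group, where $\mathsf{Cliff}(d)$ is the group generated by $\xi_1,\dots,\xi_d$ and a central element $\epsilon$ with relations $\xi_i^2=1$, $\epsilon^2=1$, $\xi_i\xi_j=\epsilon\,\xi_j\xi_i$ for $i\neq j$, and $\mathsf{S}(d)$ permutes the $\xi_i$. Grade $\mathsf{C}(d)$ by $\mathbb Z/2$ with $\deg\xi_i=1$ and $\deg g=\deg\epsilon=0$ for $g\in\mathsf{S}(d)$. A spin $\mathsf{C}(d)$-supermodule is a complex supermodule $V=V_0\oplus V_1$ over $\mathbb C[\mathsf{C}(d)]$ on which $\epsilon$ acts as $-1$. For a strict partition $\lambda$ of $d$ (a partition with distinct parts) let $V^\lambda$ be the irreducible spin $\mathsf{C}(d)$-supermodule indexed by $\lambda$. That is, $V^\lambda$ is irreducible as a supermodule and $\lambda$ is the lexicographically largest partition $\mu$ of $d$ such that $V^\lambda$ has a nonzero vector fixed by the Young subgroup $\mathsf{S}(\mu)=\mathsf{S}(\mu_1)\times \mathsf{S}(\mu_2)\times\cdots\subset\mathsf{S}(d)$.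 Put $$c_\lambda=\frac{\dim V^\lambda}{|\mathsf{C}(d)|}.$$ For a partition $\gamma$ of $d$ with all parts odd, let $C_\gamma$ be the conjugacy class in $\mathsf{C}(d)$ of a permutation in $\mathsf{S}(d)$ of cycle type $\gamma$, and let $\mathbf f_\gamma(\lambda)$ (the central character) be the constant by which the class sum $\sum_{x\in C_\gamma}x$ acts on $V^\lambda$. Let $\ell(\gamma)$ be the number of parts of $\gamma$, let $\gamma(k)$ be the number of parts equal to $k$, and put $z_\gamma=\prod_k k^{\gamma(k)}\gamma(k)!$ and $\vartheta_\gamma=2^{\ell(\gamma)+1}z_\gamma$. Then for all strict partitions $\lambda,\mu$ of $d$, $$\sum_{\gamma}\vartheta_\gamma\,\mathbf f_\gamma(\lambda)\,\mathbf f_\gamma(\mu)=\begin{cases}\dfrac{\delta_{\lambda\mu}}{2c_\lambda^2}&\text{if }\ell(\lambda)\text{ is even},\\[2ex] \dfrac{\delta_{\lambda\mu}}{c_\lambda^2}&\text{if }\ell(\lambda)\text{ is odd},\end{cases}$$ where $\gamma$ runs over all partitions of $d$ with odd parts only. -/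

import Mathlib

/-! ### The Clifford group and the Sergeev group -/

/-- The Clifford group `Cliff(d)`, generated by `ξ_1, …, ξ_d` and a central element `ε` with
`ξ_i² = 1`, `ε² = 1`, `ξ_i ξ_j = ε ξ_j ξ_i` for `i ≠ j`.  Every element has a unique normal form
`ε^s ξ_1^{a_1} ⋯ ξ_d^{a_d}` with `s, a_i ∈ ℤ/2`; the fields are `sgn = s` and `vec = a`. -/
@[ext]
structure CliffordGroup (d : ℕ) where
  /-- the exponent of `ε` -/
  sgn : ZMod 2
  /-- the exponents of `ξ_1, …, ξ_d` -/
  vec : Fin d → ZMod 2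

namespace CliffordGroup

variable {d : ℕ}

/-- `(ξ^a)(ξ^b) = ε^{cocycle a b} ξ^{a+b}`: each `ξ_j` of the second factor has to pass every `ξ_i`
of the first factor with `i > j`, and each such exchange gives one `ε`. -/
def cocycle (a b : Fin d → ZMod 2) : ZMod 2 :=
  ∑ i, ∑ j, if j < i then a i * b j else 0

theorem cocycle_add_left (a b c : Fin d → ZMod 2) :
    cocycle (a + b) c = cocycle a c + cocycle b c := by
  simp only [cocycle, ← Finset.sum_add_distrib]
  refine Finset.sum_congr rfl fun i _ => Finset.sum_congr rfl fun j _ => ?_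
  split_ifs
  · simp [add_mul]
  · simp

theorem cocycle_add_right (a b c : Fin d → ZMod 2) :
    cocycle a (b + c) = cocycle a b + cocycle a c := by
  simp only [cocycle, ← Finset.sum_add_distrib]
  refine Finset.sum_congr rfl fun i _ => Finset.sum_congr rfl fun j _ => ?_
  split_ifs
  · simp [mul_add]
  · simp

theorem cocycle_zero_left (a : Fin d → ZMod 2) : cocycle 0 a = 0 := by simp [cocycle]

theorem cocycle_zero_right (a : Fin d → ZMod 2) : cocycle a 0 = 0 := by simp [cocycle]

instance : Mul (CliffordGroup d) := ⟨fun x y => ⟨x.sgn + y.sgn + cocycle x.vec y.vec, x.vec + y.vec⟩⟩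
instance : One (CliffordGroup d) := ⟨⟨0, 0⟩⟩
instance : Inv (CliffordGroup d) := ⟨fun x => ⟨x.sgn + cocycle x.vec x.vec, x.vec⟩⟩

theorem mul_def (x y : CliffordGroup d) :
    x * y = ⟨x.sgn + y.sgn + cocycle x.vec y.vec, x.vec + y.vec⟩ := rfl
theorem one_def : (1 : CliffordGroup d) = ⟨0, 0⟩ := rfl
theorem inv_def (x : CliffordGroup d) : x⁻¹ = ⟨x.sgn + cocycle x.vec x.vec, x.vec⟩ := rfl

instance : Group (CliffordGroup d) :=
  Group.ofLeftAxioms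
    (fun x y z => by
      ext1
      · simp only [mul_def, cocycle_add_left, cocycle_add_right]; ring
      · simp only [mul_def, add_assoc])
    (fun x => by
      ext1
      · simp [mul_def, one_def, cocycle_zero_left]
      · simp [mul_def, one_def])
    (fun x => by
      ext1
      · simp only [mul_def, inv_def, one_def]
        have h := CharTwo.add_self_eq_zero (x.sgn + cocycle x.vec x.vec)
        rw [← h]; ring
      · funext i
        simp [mul_def, inv_def, one_def, CharTwo.add_self_eq_zero])

/-- The central element `ε`. -/
def eps : CliffordGroup d := ⟨1, 0⟩

/-- The generator `ξ_i`. -/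
def xi (i : Fin d) : CliffordGroup d := ⟨0, Pi.single i 1⟩

theorem eps_mul_eps : (eps : CliffordGroup d) * eps = 1 := by
  ext1
  · simp [mul_def, eps, one_def, cocycle_zero_left, CharTwo.add_self_eq_zero]
  · simp [mul_def, eps, one_def]

theorem eps_mul (x : CliffordGroup d) : eps * x = x * eps := by
  ext1
  · simp [mul_def, eps, cocycle_zero_left, cocycle_zero_right, add_comm]
  · simp [mul_def, eps]

theorem cocycle_single (i j : Fin d) :
    cocycle (Pi.single i 1) (Pi.single j 1) = if j < i then 1 else 0 := by
  unfold cocycle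
  rw [Finset.sum_eq_single i, Finset.sum_eq_single j]
  · simp
  · intro b _ hb; simp [hb]
  · simp
  · intro b _ hb; simp [hb]
  · simp

theorem xi_mul_self (i : Fin d) : xi i * xi i = 1 := by
  ext1
  · simp [mul_def, xi, one_def, cocycle_single]
  · funext k; simp [mul_def, xi, one_def, CharTwo.add_self_eq_zero]

theorem xi_mul_xi {i j : Fin d} (h : i ≠ j) : xi i * xi j = eps * (xi j * xi i) := by
  ext1
  · simp only [mul_def, xi, eps, cocycle_single, cocycle_zero_left]
    rcases lt_or_gt_of_ne h with h' | h'
    · simp [h', h'.not_gt, CharTwo.add_self_eq_zero]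
    · simp [h', h'.not_gt]
  · simp [mul_def, xi, eps, add_comm]

/-- `ξ_{g 1}^{a_1} ⋯ ξ_{g d}^{a_d} = ε^{twist g a} · (ξ^{a ∘ g⁻¹} in increasing order)`:
every inversion `i < j`, `g j < g i` with `a_i = a_j = 1` gives one `ε`. -/
def twist (g : Equiv.Perm (Fin d)) (a : Fin d → ZMod 2) : ZMod 2 :=
  ∑ i, ∑ j, if i < j ∧ g j < g i then a i * a j else 0

/-- `g (ε^s ξ_1^{a_1} ⋯ ξ_d^{a_d}) = ε^s ξ_{g 1}^{a_1} ⋯ ξ_{g d}^{a_d}`, in normal form. -/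
def permFun (g : Equiv.Perm (Fin d)) (x : CliffordGroup d) : CliffordGroup d :=
  ⟨x.sgn + twist g x.vec, fun i => x.vec (g⁻¹ i)⟩

theorem sum_antisymm (F : Fin d → Fin d → ZMod 2) (h0 : ∀ i, F i i = 0)
    (h : ∀ i j, i < j → F i j + F j i = 0) : ∑ i, ∑ j, F i j = 0 := by
  rw [← Finset.sum_product']
  refine Finset.sum_involution (fun p _ => (p.2, p.1)) ?_ ?_ ?_ ?_
  · rintro ⟨i, j⟩ _
    rcases lt_trichotomy i j with hij | rfl | hij
    · exact h i j hij
    · simp [h0]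
    · simpa [add_comm] using h j i hij
  · rintro ⟨i, j⟩ _ hne heq
    simp only [Prod.mk.injEq] at heq
    exact hne (by rw [heq.1]; exact h0 _)
  · intros; simp
  · intros; simp

theorem permFun_mul (g : Equiv.Perm (Fin d)) (x y : CliffordGroup d) :
    permFun g (x * y) = permFun g x * permFun g y := by
  ext1
  · simp only [permFun, mul_def]
    have hre : cocycle (fun i => x.vec (g⁻¹ i)) (fun i => y.vec (g⁻¹ i))
        = ∑ i, ∑ j, if g j < g i then x.vec i * y.vec j else 0 := by
      unfold cocycle
      rw [← Equiv.sum_comp g]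
      refine Finset.sum_congr rfl fun i _ => ?_
      rw [← Equiv.sum_comp g]
      simp
    have key : cocycle x.vec y.vec + twist g (x.vec + y.vec) =
        twist g x.vec + twist g y.vec
          + cocycle (fun i => x.vec (g⁻¹ i)) (fun i => y.vec (g⁻¹ i)) := by
      rw [hre, ← sub_eq_zero]
      simp only [cocycle, twist, ← Finset.sum_add_distrib, ← Finset.sum_sub_distrib]
      refine sum_antisymm _ (by simp) fun i j hij => ?_
      have hg : g i ≠ g j := fun h => hij.ne (g.injective h)
      simp only [hij, hij.not_gt, Pi.add_apply, true_and, false_and, if_true, if_false]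
      rcases lt_or_gt_of_ne hg with h | h
      · simp [h, h.not_gt]
      · simp only [h, h.not_gt, if_true, if_false]
        generalize x.vec i = p; generalize x.vec j = q
        generalize y.vec i = r; generalize y.vec j = s
        revert p q r s; decide
    linear_combination key
  · rfl

theorem permFun_comp (g h : Equiv.Perm (Fin d)) (x : CliffordGroup d) :
    permFun (g * h) x = permFun g (permFun h x) := by
  ext1
  · simp only [permFun]
    have hre : twist g (fun i => x.vec (h⁻¹ i))
        = ∑ i, ∑ j, if h i < h j ∧ g (h j) < g (h i) then x.vec i * x.vec j else 0 := by
      unfold twist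
      rw [← Equiv.sum_comp h]
      refine Finset.sum_congr rfl fun i _ => ?_
      rw [← Equiv.sum_comp h]
      simp
    have key : twist (g * h) x.vec = twist h x.vec + twist g (fun i => x.vec (h⁻¹ i)) := by
      rw [hre, ← sub_eq_zero]
      simp only [twist, ← Finset.sum_add_distrib, ← Finset.sum_sub_distrib]
      refine sum_antisymm _ (by simp) fun i j hij => ?_
      have hh : h i ≠ h j := fun e => hij.ne (h.injective e)
      have hg : g (h i) ≠ g (h j) := fun e => hh (g.injective e)
      simp only [hij, hij.not_gt, Equiv.Perm.mul_apply, true_and, false_and, if_false]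
      generalize x.vec i = p; generalize x.vec j = q
      rcases lt_or_gt_of_ne hh with h1 | h1 <;> rcases lt_or_gt_of_ne hg with h2 | h2 <;>
        simp only [h1, h1.not_gt, h2, h2.not_gt, true_and, false_and, and_true, and_false,
          if_true, if_false] <;> revert p q <;> decide
    rw [key]; ring
  · rfl

theorem permFun_one (x : CliffordGroup d) : permFun 1 x = x := by
  ext1
  · have : twist 1 x.vec = 0 := by
      unfold twist
      refine Finset.sum_eq_zero fun i _ => Finset.sum_eq_zero fun j _ => ?_
      rw [if_neg]
      rintro ⟨h1, h2⟩
      exact absurd h1 (not_lt.mpr h2.le)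
    simp [permFun, this]
  · rfl

/-- The action of the symmetric group on the Clifford group by permuting the `ξ_i`. -/
def permAction (d : ℕ) : Equiv.Perm (Fin d) →* MulAut (CliffordGroup d) where
  toFun g :=
    { toFun := permFun g
      invFun := permFun g⁻¹
      left_inv := fun x => by rw [← permFun_comp, inv_mul_cancel, permFun_one]
      right_inv := fun x => by rw [← permFun_comp, mul_inv_cancel, permFun_one]
      map_mul' := permFun_mul g }
  map_one' := by ext1 x; exact permFun_one x
  map_mul' g h := by ext1 x; exact permFun_comp g h x

theorem permAction_eps (g : Equiv.Perm (Fin d)) : permAction d g eps = eps := by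
  ext1
  · simp [permAction, permFun, eps, twist]
  · rfl

theorem permAction_xi (g : Equiv.Perm (Fin d)) (i : Fin d) :
    permAction d g (xi i) = xi (g i) := by
  ext1
  · have : twist g (Pi.single i 1) = 0 := by
      unfold twist
      refine Finset.sum_eq_zero fun k _ => Finset.sum_eq_zero fun l _ => ?_
      split_ifs with h
      · rcases eq_or_ne k i with rfl | hk
        · simp [h.1.ne']
        · simp [Pi.single_apply, hk]
      · rfl
    simp [permAction, permFun, xi, this]
  · funext k
    have h : (g⁻¹ k = i) ↔ (k = g i) := Equiv.Perm.inv_eq_iff_eq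
    simp only [permAction, permFun, xi, Pi.single_apply, MonoidHom.coe_mk, OneHom.coe_mk,
      MulEquiv.coe_mk, Equiv.coe_fn_mk, h]

/-- Elements of the Clifford group as pairs (exponent of `ε`, exponents of the `ξ_i`). -/
def equivProd : CliffordGroup d ≃ ZMod 2 × (Fin d → ZMod 2) where
  toFun x := (x.sgn, x.vec)
  invFun p := ⟨p.1, p.2⟩
  left_inv _ := rfl
  right_inv _ := rfl

instance : Fintype (CliffordGroup d) := Fintype.ofEquiv _ equivProd.symm

end CliffordGroup

/-- The Sergeev group `C(d) = Cliff(d) ⋊ S(d)`. -/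
abbrev SergeevGroup (d : ℕ) : Type :=
  CliffordGroup d ⋊[CliffordGroup.permAction d] Equiv.Perm (Fin d)

namespace SergeevGroup

variable {d : ℕ}

instance : Fintype (SergeevGroup d) := Fintype.ofEquiv _ SemidirectProduct.equivProd.symm

/-- The central element `ε` of the Sergeev group. -/
def eps : SergeevGroup d := SemidirectProduct.inl CliffordGroup.eps

/-- A pure permutation, seen in the Sergeev group. -/
def pure (g : Equiv.Perm (Fin d)) : SergeevGroup d := SemidirectProduct.inr g

/-- The `ℤ/2`-grading with `deg ξ_i = 1` and `deg g = deg ε = 0`. -/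
def deg (x : SergeevGroup d) : ZMod 2 := ∑ i, x.left.vec i

/-- The conjugacy class `C_γ` of a pure permutation of cycle type `γ`
(fixed points counted as parts of size one). -/
def conjClass (γ : d.Partition) : Set (SergeevGroup d) :=
  {x | ∃ g : Equiv.Perm (Fin d), g.partition.parts = γ.parts ∧ IsConj (pure g) x}

end SergeevGroup

/-! ### Numerical invariants of partitions -/

/-- `z_γ = ∏_k k^{γ(k)} γ(k)!`, where `γ(k)` is the number of parts of size `k`. -/
def Nat.Partition.zNum {d : ℕ} (γ : d.Partition) : ℕ :=
  ∏ k ∈ γ.parts.toFinset, k ^ γ.parts.count k * (γ.parts.count k).factorial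

/-- `ϑ_γ = 2^{ℓ(γ)+1} z_γ`, where `ℓ(γ)` is the number of parts. -/
def Nat.Partition.vartheta {d : ℕ} (γ : d.Partition) : ℕ :=
  2 ^ (γ.parts.card + 1) * γ.zNum

/-- The list of the parts of a partition in decreasing order. -/
def Nat.Partition.toList {d : ℕ} (γ : d.Partition) : List ℕ :=
  γ.parts.sort (· ≥ ·)

/-! ### Spin supermodules -/

/-- A spin `C(d)`-supermodule structure on the complex vector space `V`: a decomposition
`V = V_0 ⊕ V_1` and an action of `C(d)` for which elements of degree `j` map `V_i` to `V_{i+j}`,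
such that `ε` acts as `-1`. -/
structure SpinSupermodule (d : ℕ) (V : Type*) [AddCommGroup V] [Module ℂ V] where
  /-- the action of the Sergeev group -/
  rho : Representation ℂ (SergeevGroup d) V
  /-- the homogeneous parts `V_0`, `V_1` -/
  gr : ZMod 2 → Submodule ℂ V
  isCompl_gr : IsCompl (gr 0) (gr 1)
  map_gr : ∀ (x : SergeevGroup d) (i : ZMod 2), ∀ v ∈ gr i, rho x v ∈ gr (i + x.deg)
  rho_eps : rho SergeevGroup.eps = -1

namespace SpinSupermodule

variable {d : ℕ} {V : Type*} [AddCommGroup V] [Module ℂ V]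

/-- `V` is irreducible as a supermodule: it is nonzero, and its only graded invariant subspaces
are `0` and `V`. -/
def IsIrreducible (M : SpinSupermodule d V) : Prop :=
  Nontrivial V ∧ ∀ U : Submodule ℂ V, (∀ x : SergeevGroup d, ∀ v ∈ U, M.rho x v ∈ U) →
    U = (U ⊓ M.gr 0) ⊔ (U ⊓ M.gr 1) → U = ⊥ ∨ U = ⊤

/-- The sizes of the nonempty fibres (blocks) of a map `b` on `{1, …, d}`. -/
def blockSizes (b : Fin d → ℕ) : Multiset ℕ :=
  (Finset.univ.image b).val.map fun k => (Finset.univ.filter fun i => b i = k).card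

/-- `V` has a nonzero vector that is fixed by a Young subgroup of type `μ`, that is, by all pure
permutations that preserve each block of a decomposition of `{1, …, d}` into blocks of sizes
`μ_1, μ_2, …`.  (All Young subgroups of type `μ` are conjugate.)  By Frobenius reciprocity this
says that `V` receives a nonzero map from the spin module `Cliff_d ⊗ ℂ[S(d)/S(μ)]` induced from the
trivial module of `S(μ)`; under Sergeev duality between `C(d)` and the queer Lie superalgebra
`𝔮(n)`, it says that `μ` is a weight of the `𝔮(n)`-module corresponding to `V`. -/
def HasWeight (M : SpinSupermodule d V) (μ : d.Partition) : Prop :=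
  ∃ b : Fin d → ℕ, blockSizes b = μ.parts ∧
    ∃ v : V, v ≠ 0 ∧ ∀ g : Equiv.Perm (Fin d), (∀ i, b (g i) = b i) →
      M.rho (SergeevGroup.pure g) v = v

/-- `V` is the irreducible spin supermodule `V^lam` that is indexed by the partition `lam`: it is
irreducible and `lam` is its highest weight, the lexicographically largest one.  The assignment of
its highest weight to each irreducible spin supermodule is the usual bijection between irreducible
spin supermodules (up to isomorphism and parity change) and strict partitions of `d`:
the character of `Cliff_d ⊗ ℂ[S(d)/S(μ)]` corresponds to the symmetric function
`q_{μ_1} q_{μ_2} ⋯`, and `V^lam` corresponds to a multiple of Schur's `Q_lam`, which occurs in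
`q_{μ_1} q_{μ_2} ⋯` for `μ = lam`, and only for `μ ≤ lam`. -/
def IsIrreducibleOfIndex (M : SpinSupermodule d V) (lam : d.Partition) : Prop :=
  M.IsIrreducible ∧ M.HasWeight lam ∧ ∀ μ : d.Partition, M.HasWeight μ → μ.toList ≤ lam.toList

open Classical in
/-- The action on `V` of the class sum of the conjugacy class `C_γ`. -/
noncomputable def classSum (M : SpinSupermodule d V) (γ : d.Partition) : V →ₗ[ℂ] V :=
  ∑ x ∈ (SergeevGroup.conjClass γ).toFinset, M.rho x

/-- The central character `f_γ` of `V`: the constant by which the class sum of `C_γ` acts on `V`. -/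
noncomputable def centralChar (M : SpinSupermodule d V) (γ : d.Partition) : ℂ :=
  Classical.epsilon fun c : ℂ => M.classSum γ = c • LinearMap.id

/-- `c = dim V / |C(d)|`. -/
noncomputable def cNum (_M : SpinSupermodule d V) : ℂ :=
  (Module.finrank ℂ V : ℂ) / (Fintype.card (SergeevGroup d) : ℂ)

end SpinSupermodule

namespace CliffordGroup

variable {d : ℕ}

/-- The parity of the number of letters of an element of the Clifford group. -/
def parity (x : CliffordGroup d) : ZMod 2 := ∑ i, x.vec i

/-- The central element `ε^s`. -/
def epsPow (s : ZMod 2) : CliffordGroup d := ⟨s, 0⟩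

theorem epsPow_mul (s : ZMod 2) (x : CliffordGroup d) : epsPow s * x = ⟨s + x.sgn, x.vec⟩ := by
  ext1
  · simp [mul_def, epsPow, cocycle_zero_left]
  · simp [mul_def, epsPow]

theorem mul_epsPow (s : ZMod 2) (x : CliffordGroup d) : x * epsPow s = epsPow s * x := by
  rw [epsPow_mul]
  ext1
  · simp [mul_def, epsPow, cocycle_zero_right, add_comm]
  · simp [mul_def, epsPow]

theorem epsPow_zero : (epsPow 0 : CliffordGroup d) = 1 := rfl

theorem epsPow_one : (epsPow 1 : CliffordGroup d) = eps := rfl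

theorem eq_epsPow_mul {x y : CliffordGroup d} (h : x.vec = y.vec) :
    x = epsPow (x.sgn + y.sgn) * y := by
  rw [epsPow_mul]
  ext1
  · simp [add_assoc, CharTwo.add_self_eq_zero]
  · exact h

theorem cocycle_add_cocycle (a b : Fin d → ZMod 2) :
    cocycle a b + cocycle b a = (∑ i, a i) * (∑ i, b i) + ∑ i, a i * b i := by
  have h1 : cocycle b a = ∑ i, ∑ j, if i < j then a i * b j else 0 := by
    unfold cocycle
    rw [Finset.sum_comm]
    refine Finset.sum_congr rfl fun i _ => Finset.sum_congr rfl fun j _ => ?_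
    rw [mul_comm]
  have h2 : ∑ i, a i * b i = ∑ i, ∑ j, if i = j then a i * b j else 0 := by simp
  rw [h1, h2, Finset.sum_mul_sum]
  unfold cocycle
  simp only [← Finset.sum_add_distrib]
  refine Finset.sum_congr rfl fun i _ => Finset.sum_congr rfl fun j _ => ?_
  rcases lt_trichotomy i j with h | rfl | h
  · simp [h, h.not_gt, h.ne]
  · simp [CharTwo.add_self_eq_zero]
  · simp [h, h.not_gt, h.ne']

/-- Moving `x` past `y` gives one `ε` for each pair of distinct letters of `x` and of `y`. -/
theorem mul_eq_epsPow_mul_mul (x y : CliffordGroup d) :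
    x * y = epsPow (x.parity * y.parity + ∑ i, x.vec i * y.vec i) * (y * x) := by
  rw [epsPow_mul]
  ext1
  · have h := cocycle_add_cocycle x.vec y.vec
    have h2 := CharTwo.add_self_eq_zero (cocycle y.vec x.vec)
    simp only [mul_def, parity]
    linear_combination h - h2
  · simp [mul_def, add_comm]

theorem twist_eq_zero {g : Equiv.Perm (Fin d)} {a : Fin d → ZMod 2}
    (h : ∀ i, a i ≠ 0 → g i = i) : twist g a = 0 := by
  refine Finset.sum_eq_zero fun i _ => Finset.sum_eq_zero fun j _ => ?_
  split_ifs with hij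
  · by_cases hi : a i = 0
    · simp [hi]
    by_cases hj : a j = 0
    · simp [hj]
    rw [h i hi, h j hj] at hij
    exact absurd hij.1 hij.2.not_gt
  · rfl

/-- A permutation that fixes all letters of `x` fixes `x`. -/
theorem permAction_of_fixes {g : Equiv.Perm (Fin d)} {x : CliffordGroup d}
    (h : ∀ i, x.vec i ≠ 0 → g i = i) : permAction d g x = x := by
  ext1
  · simp [permAction, permFun, twist_eq_zero h]
  · funext i
    change x.vec (g⁻¹ i) = x.vec i
    by_cases hi : x.vec i = 0
    · by_cases hgi : x.vec (g⁻¹ i) = 0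
      · rw [hi, hgi]
      · have h1 : g (g⁻¹ i) = g⁻¹ i := h _ hgi
        have h2 : g (g⁻¹ i) = i := g.apply_symm_apply i
        rw [← h1, h2]
    · rw [Equiv.Perm.inv_eq_iff_eq.mpr (h i hi).symm]

theorem permAction_vec (g : Equiv.Perm (Fin d)) (x : CliffordGroup d) (i : Fin d) :
    (permAction d g x).vec i = x.vec (g⁻¹ i) := rfl

theorem permAction_epsPow (g : Equiv.Perm (Fin d)) (s : ZMod 2) :
    permAction d g (epsPow s) = epsPow s :=
  permAction_of_fixes fun _ hi => absurd rfl hi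

theorem permAction_swap_of_eq_zero {p q : Fin d} {x : CliffordGroup d}
    (hp : x.vec p = 0) (hq : x.vec q = 0) : permAction d (Equiv.swap p q) x = x :=
  permAction_of_fixes fun _ hi => Equiv.swap_apply_of_ne_of_ne
    (fun h => hi (h ▸ hp)) (fun h => hi (h ▸ hq))

theorem xi_vec_self (p : Fin d) : (xi p).vec p = 1 := by simp [xi]

theorem xi_vec_of_ne {p q : Fin d} (h : q ≠ p) : (xi p).vec q = 0 := by simp [xi, h]

theorem mul_vec (x y : CliffordGroup d) (i : Fin d) : (x * y).vec i = x.vec i + y.vec i := rfl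

theorem xi_parity (p : Fin d) : (xi p).parity = 1 := by simp [xi, parity]

theorem mul_xi_mul_xi (x : CliffordGroup d) (p : Fin d) : x * xi p * xi p = x := by
  rw [mul_assoc, xi_mul_self, mul_one]

theorem xi_mul_xi_mul (x : CliffordGroup d) (p : Fin d) : xi p * (xi p * x) = x := by
  rw [← mul_assoc, xi_mul_self, one_mul]

theorem permAction_swap_of_eq_one {p q : Fin d} (hpq : p ≠ q) {x : CliffordGroup d}
    (hp : x.vec p = 1) (hq : x.vec q = 1) : permAction d (Equiv.swap p q) x = eps * x := by
  obtain ⟨r, rfl⟩ : ∃ r, x = xi p * (xi q * r) :=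
    ⟨xi q * (xi p * x), by rw [xi_mul_xi_mul, xi_mul_xi_mul]⟩
  have hrp : r.vec p = 0 := by
    simpa [mul_vec, xi_vec_self, xi_vec_of_ne hpq] using hp
  have hrq : r.vec q = 0 := by
    simpa [mul_vec, xi_vec_self, xi_vec_of_ne hpq.symm] using hq
  rw [map_mul, map_mul, permAction_swap_of_eq_zero hrp hrq, permAction_xi, permAction_xi,
    Equiv.swap_apply_left, Equiv.swap_apply_right, ← mul_assoc, xi_mul_xi hpq.symm]
  simp only [mul_assoc]

theorem vec_eq_zero_or_one (x : CliffordGroup d) (i : Fin d) : x.vec i = 0 ∨ x.vec i = 1 := by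
  generalize x.vec i = a
  revert a
  decide

end CliffordGroup

namespace CliffordGroup

variable {d : ℕ} {E : Type*} [AddCommGroup E] [Module ℂ E]

theorem mem_of_natCast_smul_mem {P : Submodule ℂ E} {n : ℕ} (hn : n ≠ 0) {x : E}
    (h : (n : ℂ) • x ∈ P) : x ∈ P :=
  (P.smul_mem_iff (Nat.cast_ne_zero.mpr hn)).mp h

theorem mem_of_eq_neg {P : Submodule ℂ E} {x : E} (h : x = -x) : x ∈ P := by
  refine mem_of_natCast_smul_mem two_ne_zero ?_
  rw [Nat.cast_smul_eq_nsmul, two_nsmul, add_eq_zero_iff_eq_neg.mpr h]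
  exact P.zero_mem

theorem epsPow_mul_mem {P : Submodule ℂ E} {Ψ : CliffordGroup d → E}
    (heps : ∀ c, Ψ (eps * c) = -Ψ c) (s : ZMod 2) {c : CliffordGroup d} :
    Ψ (epsPow s * c) ∈ P ↔ Ψ c ∈ P := by
  obtain rfl | rfl : s = 0 ∨ s = 1 := by revert s; decide
  · rw [epsPow_zero, one_mul]
  · rw [epsPow_one, heps, neg_mem_iff]

/-- The linear algebra behind the straightening step: modulo `P`, the function `Ψ` is
antisymmetric in `ε`, symmetric under `K`, and killed by `1 + ∑_{q ∈ K} (p q)` both on the left of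
`ξ_p` and alone. -/
theorem mem_of_swap_relations {P : Submodule ℂ E} {Ψ : CliffordGroup d → E} {p : Fin d}
    {K : Finset (Fin d)} (hp : p ∉ K)
    (heps : ∀ c, Ψ (eps * c) = -Ψ c)
    (hsymm : ∀ q ∈ K, ∀ q' ∈ K, ∀ c, Ψ (permAction d (Equiv.swap q q') c) = Ψ c)
    (h₁ : ∀ c, Ψ c + ∑ q ∈ K, Ψ (permAction d (Equiv.swap p q) c) ∈ P)
    (h₂ : ∀ c, Ψ (c * xi p) + ∑ q ∈ K, Ψ (permAction d (Equiv.swap p q) c * xi p) ∈ P)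
    (c : CliffordGroup d) : Ψ c ∈ P := by
  have hpq : ∀ q ∈ K, q ≠ p := fun q hq h => hp (h ▸ hq)
  have hanti : ∀ c : CliffordGroup d, ∀ q ∈ K, ∀ q' ∈ K, q ≠ q' → c.vec q = 1 → c.vec q' = 1 →
      Ψ c ∈ P := by
    intro c q hq q' hq' hne h h'
    have h1 := hsymm q hq q' hq' c
    rw [permAction_swap_of_eq_one hne h h', heps] at h1
    exact mem_of_eq_neg h1.symm
  have hzero : ∀ c : CliffordGroup d, c.vec p = 0 → (∀ q ∈ K, c.vec q = 0) →
      Ψ c ∈ P ∧ Ψ (c * xi p) ∈ P := by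
    intro c hcp hcK
    have hfix : ∀ q ∈ K, permAction d (Equiv.swap p q) c = c :=
      fun q hq => permAction_swap_of_eq_zero hcp (hcK q hq)
    have e1 := h₁ c
    have e2 := h₂ c
    rw [Finset.sum_congr rfl fun q hq => by rw [hfix q hq], Finset.sum_const] at e1 e2
    constructor
    · refine mem_of_natCast_smul_mem (n := K.card + 1) (by omega) ?_
      simpa [add_smul, add_comm, Nat.cast_smul_eq_nsmul] using e1
    · refine mem_of_natCast_smul_mem (n := K.card + 1) (by omega) ?_
      simpa [add_smul, add_comm, Nat.cast_smul_eq_nsmul] using e2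
  have hmain : ∀ c : CliffordGroup d, c.vec p = 0 → Ψ c ∈ P ∧ Ψ (c * xi p) ∈ P := by
    intro c hcp
    by_cases hcK : ∀ q ∈ K, c.vec q = 0
    · exact hzero c hcp hcK
    push Not at hcK
    obtain ⟨q₀, hq₀, hne⟩ := hcK
    have hc₀ : c.vec q₀ = 1 := (vec_eq_zero_or_one c q₀).resolve_left hne
    by_cases hex : ∃ q ∈ K, q₀ ≠ q ∧ c.vec q = 1
    · obtain ⟨q, hq, hqq, hcq⟩ := hex
      refine ⟨hanti c q₀ hq₀ q hq hqq hc₀ hcq, hanti _ q₀ hq₀ q hq hqq ?_ ?_⟩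
      · rw [mul_vec, xi_vec_of_ne (hpq _ hq₀), hc₀, add_zero]
      · rw [mul_vec, xi_vec_of_ne (hpq _ hq), hcq, add_zero]
    push Not at hex
    obtain ⟨r, rfl⟩ : ∃ r, c = xi q₀ * r := ⟨xi q₀ * c, by rw [xi_mul_xi_mul]⟩
    have hrp : r.vec p = 0 := by
      simpa [mul_vec, xi_vec_of_ne (hpq _ hq₀).symm] using hcp
    have hrq₀ : r.vec q₀ = 0 := by simpa [mul_vec, xi_vec_self] using hc₀
    have hrK : ∀ q ∈ K, r.vec q = 0 := by
      intro q hq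
      by_cases h : q₀ = q
      · rw [← h, hrq₀]
      · have h1 := (vec_eq_zero_or_one _ q).resolve_right (hex q hq h)
        rwa [mul_vec, xi_vec_of_ne (Ne.symm h), zero_add] at h1
    have hr := hzero r hrp hrK
    have hswap₀ : permAction d (Equiv.swap p q₀) (xi q₀ * r) = xi p * r := by
      rw [map_mul, permAction_xi, Equiv.swap_apply_right, permAction_swap_of_eq_zero hrp hrq₀]
    have hswap : ∀ q ∈ K.erase q₀, permAction d (Equiv.swap p q) (xi q₀ * r) = xi q₀ * r := by
      intro q hq
      obtain ⟨hqq, hq⟩ := Finset.mem_erase.mp hq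
      refine permAction_swap_of_eq_zero hcp ?_
      rw [mul_vec, xi_vec_of_ne hqq, hrK q hq, add_zero]
    have hcard : (K.erase q₀).card + 1 ≠ 0 := by omega
    have e1 := h₁ (xi q₀ * r)
    have e2 := h₂ (xi q₀ * r)
    rw [← Finset.add_sum_erase _ _ hq₀, hswap₀,
      Finset.sum_congr rfl fun q hq => by rw [hswap q hq], Finset.sum_const] at e1 e2
    have hmem₁ : Ψ (xi p * r) ∈ P := by
      rw [mul_eq_epsPow_mul_mul, epsPow_mul_mem heps]
      exact hr.2
    have hmem₂ : Ψ (xi p * r * xi p) ∈ P := by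
      rw [mul_assoc, mul_eq_epsPow_mul_mul, epsPow_mul_mem heps, mul_xi_mul_xi]
      exact hr.1
    constructor
    · refine mem_of_natCast_smul_mem hcard ?_
      have := P.sub_mem e1 hmem₁
      convert this using 1
      push_cast
      rw [add_smul, Nat.cast_smul_eq_nsmul, one_smul]
      abel
    · refine mem_of_natCast_smul_mem hcard ?_
      have := P.sub_mem e2 hmem₂
      convert this using 1
      push_cast
      rw [add_smul, Nat.cast_smul_eq_nsmul, one_smul]
      abel
  rcases vec_eq_zero_or_one c p with h | h
  · exact (hmain c h).1
  · rw [← mul_xi_mul_xi c p]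
    refine (hmain (c * xi p) ?_).2
    rw [mul_vec, h, xi_vec_self]
    decide

end CliffordGroup

/-- The smallest subspace that contains `u` and is stable under the operators `H j`, `j ∈ s`. -/
def stableSpan {ι E : Type*} [AddCommGroup E] [Module ℂ E] (H : ι → E →ₗ[ℂ] E) (s : Set ι)
    (u : E) : Submodule ℂ E :=
  sInf {U | u ∈ U ∧ ∀ j ∈ s, ∀ x ∈ U, H j x ∈ U}

section stableSpan

variable {ι E : Type*} [AddCommGroup E] [Module ℂ E] {H : ι → E →ₗ[ℂ] E} {s : Set ι} {u : E}

theorem mem_stableSpan_self : u ∈ stableSpan H s u :=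
  Submodule.mem_sInf.mpr fun _ hU => hU.1

theorem apply_mem_stableSpan {j : ι} (hj : j ∈ s) {x : E} (hx : x ∈ stableSpan H s u) :
    H j x ∈ stableSpan H s u :=
  Submodule.mem_sInf.mpr fun U hU => hU.2 j hj x (Submodule.mem_sInf.mp hx U hU)

theorem stableSpan_le {U : Submodule ℂ E} (hu : u ∈ U) (hU : ∀ j ∈ s, ∀ x ∈ U, H j x ∈ U) :
    stableSpan H s u ≤ U :=
  sInf_le ⟨hu, hU⟩

end stableSpan

namespace SergeevGroup

variable {d : ℕ}

/-- An element of the Clifford group, seen in the Sergeev group. -/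
def cl (c : CliffordGroup d) : SergeevGroup d := SemidirectProduct.inl c

theorem cl_mul (c c' : CliffordGroup d) : cl (c * c') = cl c * cl c' := map_mul _ _ _

theorem cl_eps : cl (CliffordGroup.eps : CliffordGroup d) = eps := rfl

theorem cl_one : cl (1 : CliffordGroup d) = 1 := rfl

theorem pure_mul (g h : Equiv.Perm (Fin d)) : pure (g * h) = pure g * pure h := map_mul _ _ _

theorem pure_one : pure (1 : Equiv.Perm (Fin d)) = 1 := rfl

theorem pure_mul_cl (g : Equiv.Perm (Fin d)) (c : CliffordGroup d) :
    pure g * cl c = cl (CliffordGroup.permAction d g c) * pure g := by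
  simp [pure, cl, SemidirectProduct.inl_aut]

theorem eq_cl_mul_pure (x : SergeevGroup d) : x = cl x.left * pure x.right :=
  (SemidirectProduct.inl_left_mul_inr_right x).symm

section Young

variable {E : Type*} [AddCommGroup E] [Module ℂ E] (ρ : Representation ℂ (SergeevGroup d) E)
  (b : Fin d → ℕ)

/-- The vectors fixed by the Young subgroup of the permutations that preserve the blocks of `b`. -/
def youngInvariants : Submodule ℂ E where
  carrier := {v | ∀ g : Equiv.Perm (Fin d), (∀ i, b (g i) = b i) → ρ (pure g) v = v}
  add_mem' hx hy g hg := by rw [map_add, hx g hg, hy g hg]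
  zero_mem' g _ := map_zero _
  smul_mem' c x hx g hg := by rw [map_smul, hx g hg]

theorem mem_youngInvariants {v : E} : v ∈ youngInvariants ρ b ↔
    ∀ g : Equiv.Perm (Fin d), (∀ i, b (g i) = b i) → ρ (pure g) v = v := Iff.rfl

/-- The sum of the elements of a Young subgroup. -/
noncomputable def youngSum : E →ₗ[ℂ] E :=
  ∑ h : Equiv.Perm (Fin d) with ∀ i, b (h i) = b i, ρ (pure h)

/-- The sum of the `ξ_i` over a block. -/
noncomputable def blockXi (k : ℕ) : E →ₗ[ℂ] E :=
  ∑ i with b i = k, ρ (cl (CliffordGroup.xi i))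

variable {ρ b}

theorem rho_apply_apply (x y : SergeevGroup d) (v : E) : ρ x (ρ y v) = ρ (x * y) v := by
  rw [map_mul, Module.End.mul_apply]

theorem youngSum_apply (x : E) :
    youngSum ρ b x = ∑ h : Equiv.Perm (Fin d) with ∀ i, b (h i) = b i, ρ (pure h) x := by
  simp [youngSum]

theorem blockXi_apply (k : ℕ) (x : E) :
    blockXi ρ b k x = ∑ i with b i = k, ρ (cl (CliffordGroup.xi i)) x := by
  simp [blockXi]

theorem pure_blockXi {g : Equiv.Perm (Fin d)} (hg : ∀ i, b (g i) = b i) (k : ℕ) (x : E) :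
    ρ (pure g) (blockXi ρ b k x) = blockXi ρ b k (ρ (pure g) x) := by
  rw [blockXi_apply, blockXi_apply, map_sum]
  refine Finset.sum_equiv g (by simp [hg]) fun i _ => ?_
  rw [rho_apply_apply, rho_apply_apply, pure_mul_cl, CliffordGroup.permAction_xi]

theorem blockXi_mem_youngInvariants {v : E} (hv : v ∈ youngInvariants ρ b) (k : ℕ) :
    blockXi ρ b k v ∈ youngInvariants ρ b := fun g hg => by
  rw [pure_blockXi hg, hv g hg]

theorem youngSum_blockXi (k : ℕ) (x : E) :
    youngSum ρ b (blockXi ρ b k x) = blockXi ρ b k (youngSum ρ b x) := by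
  rw [youngSum_apply, youngSum_apply, map_sum]
  exact Finset.sum_congr rfl fun g hg => pure_blockXi (Finset.mem_filter.mp hg).2 k x

theorem youngSum_pure {g : Equiv.Perm (Fin d)} (hg : ∀ i, b (g i) = b i) (x : E) :
    youngSum ρ b (ρ (pure g) x) = youngSum ρ b x := by
  rw [youngSum_apply, youngSum_apply]
  have hg' : ∀ i, b (g⁻¹ i) = b i := fun i => by
    rw [← hg (g⁻¹ i)]; exact congrArg b (g.apply_symm_apply i)
  refine Finset.sum_equiv (Equiv.mulRight g) (fun h => ?_) fun h _ => by
    rw [rho_apply_apply, ← pure_mul, Equiv.coe_mulRight]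
  simp only [Finset.mem_filter, Finset.mem_univ, true_and, Equiv.coe_mulRight,
    Equiv.Perm.mul_apply]
  refine ⟨fun H i => by rw [H, hg], fun H i => ?_⟩
  have := H (g⁻¹ i)
  rwa [show g (g⁻¹ i) = i from g.apply_symm_apply i, hg'] at this

theorem youngSum_of_mem {v : E} (hv : v ∈ youngInvariants ρ b) :
    ∃ n : ℕ, n ≠ 0 ∧ youngSum ρ b v = (n : ℂ) • v := by
  refine ⟨(Finset.univ.filter fun h : Equiv.Perm (Fin d) => ∀ i, b (h i) = b i).card, ?_, ?_⟩
  · exact (Finset.card_pos.mpr ⟨1, by simp⟩).ne'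
  · rw [youngSum_apply, Finset.sum_congr rfl fun g hg => hv g (Finset.mem_filter.mp hg).2]
    rw [Finset.sum_const, Nat.cast_smul_eq_nsmul]

/-- Symmetrizing an invariant of one Young subgroup gives an invariant of the Young subgroup with
the letter `l` moved to block `i`. -/
theorem sum_swap_mem_youngInvariants {v : E} (hv : v ∈ youngInvariants ρ b) (l : Fin d) (i : ℕ)
    (c : Fin d → SergeevGroup d) (hc : ∀ g k, pure g * c k = c (g k) * pure g) :
    ∑ k with Function.update b l i k = i, ρ (c k) (ρ (pure (Equiv.swap l k)) v) ∈
      youngInvariants ρ (Function.update b l i) := by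
  intro g hg
  have hl : Function.update b l i l = i := Function.update_self ..
  have hswap : ∀ k, Function.update b l i k = i →
      ∀ m, Function.update b l i (Equiv.swap l k m) = Function.update b l i m := by
    intro k hk m
    rw [Equiv.swap_apply_def]
    split_ifs with h1 h2
    · rw [h1, hk, hl]
    · rw [h2, hk, hl]
    · rfl
  rw [map_sum]
  refine Finset.sum_equiv g (by simp [hg]) fun k hk => ?_
  have hk : Function.update b l i k = i := (Finset.mem_filter.mp hk).2
  have hgk : Function.update b l i (g k) = i := by rw [hg, hk]
  have hσ : ∀ m, b ((Equiv.swap l (g k) * g * Equiv.swap l k) m) = b m := by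
    intro m
    have hσl : (Equiv.swap l (g k) * g * Equiv.swap l k) l = l := by simp
    by_cases hm : m = l
    · rw [hm, hσl]
    · have hσm : (Equiv.swap l (g k) * g * Equiv.swap l k) m ≠ l := fun h =>
        hm ((Equiv.swap l (g k) * g * Equiv.swap l k).injective (h.trans hσl.symm))
      have h1 : Function.update b l i ((Equiv.swap l (g k) * g * Equiv.swap l k) m) =
          Function.update b l i m := by
        simp only [Equiv.Perm.mul_apply]
        rw [hswap _ hgk, hg, hswap _ hk]
      rwa [Function.update_of_ne hσm, Function.update_of_ne hm] at h1
  have h2 : g * Equiv.swap l k =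
      Equiv.swap l (g k) * (Equiv.swap l (g k) * g * Equiv.swap l k) := by
    simp [← mul_assoc]
  have h3 : pure g * (c k * pure (Equiv.swap l k)) = c (g k) * pure (Equiv.swap l (g k)) *
      pure (Equiv.swap l (g k) * g * Equiv.swap l k) := by
    rw [← mul_assoc, hc, mul_assoc, mul_assoc, ← pure_mul, ← pure_mul, h2]
  rw [rho_apply_apply, rho_apply_apply, mul_assoc (pure g), h3, ← rho_apply_apply, hv _ hσ, rho_apply_apply]

theorem raising_relation {v : E} (hv : v ∈ youngInvariants ρ b) {l : Fin d} {i : ℕ} (hl : b l ≠ i)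
    (h0 : youngInvariants ρ (Function.update b l i) = ⊥)
    (c : Fin d → SergeevGroup d) (hc : ∀ g k, pure g * c k = c (g k) * pure g) :
    ρ (c l) v + ∑ k with b k = i, ρ (c k) (ρ (pure (Equiv.swap l k)) v) = 0 := by
  have h := sum_swap_mem_youngInvariants hv l i c hc
  rw [h0, Submodule.mem_bot] at h
  have hset : (Finset.univ.filter fun k => Function.update b l i k = i) =
      insert l (Finset.univ.filter fun k => b k = i) := by
    ext k
    by_cases hk : k = l
    · simp [hk]
    · simp [hk]
  rw [hset, Finset.sum_insert (by simpa using hl), Equiv.swap_self] at h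
  have h1 : ρ (pure (Equiv.refl (Fin d))) v = v := by
    rw [show Equiv.refl (Fin d) = 1 from rfl, pure_one, map_one, Module.End.one_apply]
  rwa [h1] at h

end Young

end SergeevGroup

namespace SergeevGroup

variable {d : ℕ} {E : Type*} [AddCommGroup E] [Module ℂ E]
  {ρ : Representation ℂ (SergeevGroup d) E} {b : Fin d → ℕ} {v : E}

open CliffordGroup (permAction xi)

theorem rho_cl_eps_mul (hε : ρ eps = -1) (c : CliffordGroup d) (x : SergeevGroup d) (v : E) :
    ρ (cl (CliffordGroup.eps * c) * x) v = -ρ (cl c * x) v := by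
  rw [cl_mul, cl_eps, mul_assoc, map_mul, hε]
  simp

theorem card_fibre_pos (b : Fin d → ℕ) (m : Fin d) :
    0 < (Finset.univ.filter fun i => b i = b m).card := by
  rw [Finset.card_pos]
  exact ⟨m, by simp⟩

theorem swap_preserves {p q : Fin d} (h : b p = b q) (i : Fin d) :
    b (Equiv.swap p q i) = b i := by
  rw [Equiv.swap_apply_def]
  split_ifs with h1 h2
  · rw [h1, h]
  · rw [h2, h]
  · rfl

theorem youngSum_permAction {h : Equiv.Perm (Fin d)} (hh : ∀ i, b (h i) = b i)
    (c : CliffordGroup d) (g : Equiv.Perm (Fin d)) :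
    youngSum ρ b (ρ (cl (permAction d h c) * pure (h * g)) v) =
      youngSum ρ b (ρ (cl c * pure g) v) := by
  rw [pure_mul, ← mul_assoc, ← pure_mul_cl, mul_assoc, ← rho_apply_apply, youngSum_pure hh]

theorem rho_mul_pure_of_mem (hv : v ∈ youngInvariants ρ b) {h : Equiv.Perm (Fin d)}
    (hh : ∀ i, b (h i) = b i) (x : SergeevGroup d) : ρ (x * pure h) v = ρ x v := by
  rw [← rho_apply_apply, hv h hh]

theorem youngSum_cl_mem (hε : ρ eps = -1) (hv : v ∈ youngInvariants ρ b)
    (c : CliffordGroup d) :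
    youngSum ρ b (ρ (cl c) v) ∈ stableSpan (blockXi ρ b) Set.univ v := by
  set P := stableSpan (blockXi ρ b) Set.univ v
  set Ψ : CliffordGroup d → E := fun c => youngSum ρ b (ρ (cl c) v) with hΨ
  have heps : ∀ c, Ψ (CliffordGroup.eps * c) = -Ψ c := fun c => by
    have := rho_cl_eps_mul hε c 1 v
    rw [mul_one, mul_one] at this
    simp only [hΨ, this, map_neg]
  have hperm : ∀ h : Equiv.Perm (Fin d), (∀ i, b (h i) = b i) → ∀ c,
      Ψ (permAction d h c) = Ψ c := fun h hh c => by
    have := youngSum_permAction (ρ := ρ) (v := v) hh c 1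
    rwa [mul_one, rho_mul_pure_of_mem hv hh, pure_one, mul_one] at this
  suffices H : ∀ (s : Finset (Fin d)) (c : CliffordGroup d), (∀ i, i ∉ s → c.vec i = 0) →
      Ψ c ∈ P from H Finset.univ c fun i hi => absurd (Finset.mem_univ i) hi
  intro s
  induction s using Finset.induction_on with
  | empty =>
    intro c hc
    have h0 : c.vec = (1 : CliffordGroup d).vec := funext fun i => hc i (Finset.notMem_empty i)
    rw [CliffordGroup.eq_epsPow_mul h0, CliffordGroup.epsPow_mul_mem heps]
    simp only [hΨ, cl_one, map_one, Module.End.one_apply]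
    obtain ⟨n, -, hn⟩ := youngSum_of_mem hv
    rw [hn]
    exact P.smul_mem _ mem_stableSpan_self
  | insert k s hk ih =>
    intro c hc
    rcases c.vec_eq_zero_or_one k with hck | hck
    · refine ih c fun i hi => ?_
      by_cases hik : i = k
      · rwa [hik]
      · exact hc i (by simp [hik, hi])
    by_cases hex : ∃ k', k ≠ k' ∧ b k = b k' ∧ c.vec k' = 1
    · obtain ⟨k', hkk', hb, hck'⟩ := hex
      refine CliffordGroup.mem_of_eq_neg ?_
      rw [← heps, ← CliffordGroup.permAction_swap_of_eq_one hkk' hck hck',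
        hperm _ (swap_preserves hb)]
    push Not at hex
    obtain ⟨r, rfl⟩ : ∃ r, c = xi k * r := ⟨xi k * c, by rw [CliffordGroup.xi_mul_xi_mul]⟩
    have hrk : r.vec k = 0 := by
      simpa [CliffordGroup.mul_vec, CliffordGroup.xi_vec_self] using hck
    have hr : ∀ i, i ≠ k → r.vec i = (xi k * r).vec i := fun i hi => by
      rw [CliffordGroup.mul_vec, CliffordGroup.xi_vec_of_ne hi, zero_add]
    have hrP : Ψ r ∈ P := by
      refine ih r fun i hi => ?_
      by_cases hik : i = k
      · rwa [hik]
      · rw [hr i hik]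
        exact hc i (by simp [hik, hi])
    have hconst : ∀ k', b k' = b k → Ψ (xi k' * r) = Ψ (xi k * r) := by
      intro k' hk'
      rw [← hperm _ (swap_preserves hk'.symm) (xi k * r), map_mul, CliffordGroup.permAction_xi,
        Equiv.swap_apply_left]
      congr 2
      refine (CliffordGroup.permAction_swap_of_eq_zero hrk ?_).symm
      by_cases hkk : k' = k
      · rwa [hkk]
      · rw [hr k' hkk]
        exact (CliffordGroup.vec_eq_zero_or_one _ k').resolve_right
          (hex k' (Ne.symm hkk) hk'.symm)
    have hsum : blockXi ρ b (b k) (Ψ r) =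
        ((Finset.univ.filter fun i => b i = b k).card : ℂ) • Ψ (xi k * r) := by
      simp only [hΨ]
      rw [← youngSum_blockXi, blockXi_apply, map_sum, Nat.cast_smul_eq_nsmul,
        ← Finset.sum_const]
      refine Finset.sum_congr rfl fun i hi => ?_
      rw [rho_apply_apply, ← cl_mul]
      exact hconst i (Finset.mem_filter.mp hi).2
    have hcard : (Finset.univ.filter fun i => b i = b k).card ≠ 0 :=
      (card_fibre_pos b k).ne'
    refine CliffordGroup.mem_of_natCast_smul_mem hcard ?_
    rw [← hsum]
    exact apply_mem_stableSpan (Set.mem_univ _) hrP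

/-- A permutation that does not preserve the blocks moves some letter to another block that is at
least as large. -/
theorem exists_lt_of_not_preserves {g : Equiv.Perm (Fin d)} (hg : ¬ ∀ i, b (g i) = b i) :
    ∃ l, b l ≠ b (g l) ∧ (Finset.univ.filter fun i => b i = b l).card ≤
      (Finset.univ.filter fun i => b i = b (g l)).card := by
  by_contra! H
  push Not at hg
  obtain ⟨i, hi⟩ := hg
  have h := Equiv.sum_comp g fun m => (Finset.univ.filter fun i => b i = b m).card
  refine absurd h (Finset.sum_lt_sum (fun m _ => ?_) ⟨i, Finset.mem_univ i, ?_⟩).ne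
  · by_cases hm : b m = b (g m)
    · rw [hm]
    · exact (H m hm).le
  · exact H i (Ne.symm hi)

theorem youngSum_mem_stableSpan (hε : ρ eps = -1) (hv : v ∈ youngInvariants ρ b)
    (hraise : ∀ l m, b l ≠ b m → (Finset.univ.filter fun i => b i = b l).card ≤
      (Finset.univ.filter fun i => b i = b m).card →
      youngInvariants ρ (Function.update b l (b m)) = ⊥)
    (c : CliffordGroup d) (g : Equiv.Perm (Fin d)) :
    youngSum ρ b (ρ (cl c * pure g) v) ∈ stableSpan (blockXi ρ b) Set.univ v := by
  set P := stableSpan (blockXi ρ b) Set.univ v with hP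
  induction hn : d - (Finset.univ.filter fun m => b (g m) = b m).card using Nat.strong_induction_on
    generalizing g c with
  | _ n ih =>
  subst hn
  by_cases hg : ∀ i, b (g i) = b i
  · rw [rho_mul_pure_of_mem hv hg]
    exact youngSum_cl_mem hε hv c
  obtain ⟨l, hl, hcard⟩ := exists_lt_of_not_preserves hg
  have h0 := hraise l (g l) hl hcard
  set i := b (g l) with hi
  have hlt : ∀ k, b k = i → b (g k) ≠ i → ∀ c,
      youngSum ρ b (ρ (cl c * pure (g * Equiv.swap l k)) v) ∈ P := by
    intro k hk hgk c
    refine ih _ ?_ c (g * Equiv.swap l k) rfl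
    have hkl : k ≠ l := fun h => hl (h ▸ hk)
    have hsub : (Finset.univ.filter fun m => b (g m) = b m) ⊂
        Finset.univ.filter fun m => b ((g * Equiv.swap l k) m) = b m := by
      refine Finset.ssubset_iff_subset_ne.mpr ⟨fun m hm => ?_, fun h => ?_⟩
      · have hm := (Finset.mem_filter.mp hm).2
        have hml : m ≠ l := by rintro rfl; exact hl hm.symm
        have hmk : m ≠ k := by rintro rfl; exact hgk (hm.trans hk)
        refine Finset.mem_filter.mpr ⟨Finset.mem_univ m, ?_⟩
        rwa [Equiv.Perm.mul_apply, Equiv.swap_apply_of_ne_of_ne hml hmk]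
      · have hmem : k ∈ Finset.univ.filter fun m => b ((g * Equiv.swap l k) m) = b m := by
          refine Finset.mem_filter.mpr ⟨Finset.mem_univ k, ?_⟩
          rw [Equiv.Perm.mul_apply, Equiv.swap_apply_right, hk]
        rw [← h] at hmem
        simp only [Finset.mem_filter, Finset.mem_univ, true_and] at hmem
        exact hgk (hmem.trans hk)
    have h1 := Finset.card_lt_card hsub
    have h2 := Finset.card_le_univ
      (Finset.univ.filter fun m => b ((g * Equiv.swap l k) m) = b m)
    rw [Fintype.card_fin] at h2
    omega
  set Ψ : CliffordGroup d → E := fun c => youngSum ρ b (ρ (cl c * pure g) v) with hΨ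
  set K₀ : Finset (Fin d) := Finset.univ.filter fun k => b k = i ∧ b (g k) = i with hK₀
  have hmul : ∀ k, g * Equiv.swap l k = Equiv.swap (g l) (g k) * g := fun k => by
    rw [Equiv.mul_swap_eq_swap_mul]
  have hswapΨ : ∀ k, b (g k) = i → ∀ c,
      youngSum ρ b (ρ (cl c * pure (g * Equiv.swap l k)) v) =
        Ψ (permAction d (Equiv.swap (g l) (g k)) c) := by
    intro k hk c
    have h1 : permAction d (Equiv.swap (g l) (g k))
        (permAction d (Equiv.swap (g l) (g k)) c) = c := by
      rw [← MulAut.mul_apply, ← map_mul, Equiv.swap_mul_self, map_one, MulAut.one_apply]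
    rw [hmul]
    conv_lhs => rw [← h1]
    exact youngSum_permAction (swap_preserves (hi.symm.trans hk.symm)) _ _
  have hsplit : ∀ F : Fin d → CliffordGroup d,
      Ψ (F l) + ∑ k with b k = i, youngSum ρ b (ρ (cl (F k) * pure (g * Equiv.swap l k)) v) = 0 →
      Ψ (F l) + ∑ k ∈ K₀, Ψ (permAction d (Equiv.swap (g l) (g k)) (F k)) ∈ P := by
    intro F hF
    rw [← Finset.sum_filter_add_sum_filter_not _ (fun k => b (g k) = i), Finset.filter_filter,
      ← add_assoc] at hF
    rw [← Finset.sum_congr rfl fun k hk => hswapΨ k (Finset.mem_filter.mp hk).2.2 (F k),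
      eq_neg_of_add_eq_zero_left hF]
    refine P.neg_mem (P.sum_mem fun k hk => ?_)
    simp only [Finset.mem_filter, Finset.mem_univ, true_and] at hk
    exact hlt k hk.1 hk.2 (F k)
  have hgl : g l ∉ K₀.map g.toEmbedding := by
    simp only [Finset.mem_map_equiv, hK₀, Finset.mem_filter, Finset.mem_univ, true_and,
      Equiv.symm_apply_apply]
    exact fun h => hl h.1
  refine CliffordGroup.mem_of_swap_relations (Ψ := Ψ) hgl ?_ ?_ ?_ ?_ c
  · intro c
    simp only [hΨ, rho_cl_eps_mul hε, map_neg]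
  · intro q hq q' hq' c
    simp only [Finset.mem_map, hK₀, Finset.mem_filter, Finset.mem_univ, true_and,
      Equiv.coe_toEmbedding] at hq hq'
    obtain ⟨k, hk, rfl⟩ := hq
    obtain ⟨k', hk', rfl⟩ := hq'
    have h1 := youngSum_permAction (ρ := ρ) (v := v)
      (swap_preserves (hk.2.trans hk'.2.symm)) c g
    have h2 : Equiv.swap (g k) (g k') * g = g * Equiv.swap k k' := by
      rw [Equiv.mul_swap_eq_swap_mul]
    rw [h2, pure_mul, ← mul_assoc,
      rho_mul_pure_of_mem hv (swap_preserves (hk.1.trans hk'.1.symm))] at h1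
    exact h1
  · intro c
    rw [Finset.sum_map]
    refine hsplit (fun _ => c) ?_
    have h1 := congrArg (fun x => youngSum ρ b (ρ (cl c * pure g) x))
      (raising_relation hv hl h0 (fun _ => 1) fun g k => by rw [mul_one, one_mul])
    simp only [map_one, Module.End.one_apply, map_add, map_sum, map_zero, rho_apply_apply,
      mul_assoc, ← pure_mul] at h1
    exact h1
  · intro c
    rw [Finset.sum_map]
    have h1 := congrArg (fun x => youngSum ρ b (ρ (cl c * pure g) x))
      (raising_relation hv hl h0 (fun k => cl (xi k)) fun g k => by
        rw [pure_mul_cl, CliffordGroup.permAction_xi])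
    have h2 : ∀ k, cl c * (pure g * (cl (xi k) * pure (Equiv.swap l k))) =
        cl (c * xi (g k)) * pure (g * Equiv.swap l k) := fun k => by
      rw [← mul_assoc (pure g), pure_mul_cl, CliffordGroup.permAction_xi, cl_mul, pure_mul]
      simp only [mul_assoc]
    have h3 : cl c * (pure g * cl (xi l)) = cl (c * xi (g l)) * pure g := by
      rw [pure_mul_cl, CliffordGroup.permAction_xi, cl_mul, mul_assoc]
    simp only [map_add, map_sum, map_zero, rho_apply_apply, mul_assoc, h2, h3] at h1
    have h4 := hsplit (fun k => c * xi (g k)) h1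
    simpa only [map_mul, CliffordGroup.permAction_xi, Equiv.swap_apply_right,
      Equiv.coe_toEmbedding] using h4

/-- Two invariants of the Young subgroup of `b`, the second in the submodule generated by the
first, differ by the Clifford algebra of the `blockXi`, when no raised Young subgroup has
invariants. -/
theorem mem_stableSpan_of_mem_span (hε : ρ eps = -1) (hv : v ∈ youngInvariants ρ b)
    (hraise : ∀ l m, b l ≠ b m → (Finset.univ.filter fun i => b i = b l).card ≤
      (Finset.univ.filter fun i => b i = b m).card →
      youngInvariants ρ (Function.update b l (b m)) = ⊥)
    {w : E} (hw : w ∈ youngInvariants ρ b) (hwv : w ∈ Submodule.span ℂ (Set.range fun x => ρ x v)) :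
    w ∈ stableSpan (blockXi ρ b) Set.univ v := by
  obtain ⟨n, hn, hnw⟩ := youngSum_of_mem hw
  refine CliffordGroup.mem_of_natCast_smul_mem hn ?_
  rw [← hnw]
  have hle : Submodule.span ℂ (Set.range fun x => ρ x v) ≤
      (stableSpan (blockXi ρ b) Set.univ v).comap (youngSum ρ b) := by
    rw [Submodule.span_le]
    rintro _ ⟨x, rfl⟩
    change youngSum ρ b (ρ x v) ∈ stableSpan (blockXi ρ b) Set.univ v
    rw [eq_cl_mul_pure x]
    exact youngSum_mem_stableSpan hε hv hraise _ _
  exact hle hwv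

end SergeevGroup

/-- Two weakly decreasing lists compare lexicographically as the multiplicities of the largest
entry in which they differ. -/
theorem List.lt_of_count_lt {t : ℕ} : ∀ {l₁ l₂ : List ℕ}, l₁.Pairwise (· ≥ ·) →
    l₂.Pairwise (· ≥ ·) → (∀ s, t < s → l₁.count s = l₂.count s) → l₁.count t < l₂.count t →
    l₁ < l₂
  | _, [], _, _, _, h => by simp at h
  | [], _ :: _, _, _, _, _ => List.nil_lt_cons _ _
  | a :: l₁, c :: l₂, h₁, h₂, hs, ht => by
    rw [List.cons_lt_cons_iff]
    rcases lt_trichotomy a c with h | rfl | h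
    · exact Or.inl h
    · refine Or.inr ⟨rfl, List.lt_of_count_lt (t := t) h₁.of_cons h₂.of_cons (fun s hs' => ?_) ?_⟩
      · have := hs s hs'
        simp only [List.count_cons] at this
        omega
      · simp only [List.count_cons] at ht
        omega
    · exfalso
      have hle : ∀ x ∈ c :: l₂, x ≤ c := by
        intro x hx
        rcases List.mem_cons.mp hx with rfl | hx
        · exact le_rfl
        · exact List.rel_of_pairwise_cons h₂ hx
      have htc : t ≤ c := hle t (List.count_pos_iff.mp (by omega))
      have h0 := hs a (by omega)
      rw [List.count_eq_zero_of_not_mem (a := a) (l := c :: l₂)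
        (fun hm => absurd (hle a hm) (by omega))] at h0
      simp at h0

theorem Nat.Partition.count_toList {d : ℕ} (γ : d.Partition) (s : ℕ) :
    γ.toList.count s = γ.parts.count s := by
  rw [← Multiset.coe_count, Nat.Partition.toList, Multiset.sort_eq]

namespace SpinSupermodule

variable {d : ℕ} {V : Type*} [AddCommGroup V] [Module ℂ V]

/-- The partition formed by the block sizes. -/
def blockPartition (b : Fin d → ℕ) : d.Partition where
  parts := blockSizes b
  parts_pos {i} hi := by
    simp only [blockSizes, Multiset.mem_map, Finset.mem_val, Finset.mem_image, Finset.mem_univ,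
      true_and] at hi
    obtain ⟨_, ⟨m, rfl⟩, rfl⟩ := hi
    exact SergeevGroup.card_fibre_pos b m
  parts_sum := by
    have := Finset.card_eq_sum_card_image b Finset.univ
    rw [Finset.card_univ, Fintype.card_fin] at this
    exact this.symm

theorem count_blockSizes (b : Fin d → ℕ) (s : ℕ) : (blockSizes b).count s =
    ((Finset.univ.image b).filter fun k =>
      s = (Finset.univ.filter fun i => b i = k).card).card := by
  rw [blockSizes, Multiset.count_map]
  rfl

theorem card_fibre_update (b : Fin d → ℕ) {l m : Fin d} (h : b l ≠ b m) (k : ℕ) :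
    (Finset.univ.filter fun i => Function.update b l (b m) i = k).card =
      if k = b m then (Finset.univ.filter fun i => b i = b m).card + 1
      else if k = b l then (Finset.univ.filter fun i => b i = b l).card - 1
      else (Finset.univ.filter fun i => b i = k).card := by
  split_ifs with h1 h2
  · subst h1
    rw [← Finset.card_insert_of_notMem (a := l) (by simp [h])]
    congr 1
    ext i
    by_cases hi : i = l <;> simp [hi]
  · subst h2
    rw [← Finset.card_erase_of_mem (a := l) (by simp)]
    congr 1
    ext i
    by_cases hi : i = l
    · simp [hi, Ne.symm h]
    · simp [hi]
  · congr 1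
    ext i
    by_cases hi : i = l
    · simp [hi, Ne.symm h1, Ne.symm h2]
    · simp [hi]

theorem toList_lt_blockPartition_update {b : Fin d → ℕ} {lam : d.Partition}
    (hb : blockSizes b = lam.parts) {l m : Fin d} (h : b l ≠ b m)
    (hcard : (Finset.univ.filter fun i => b i = b l).card ≤
      (Finset.univ.filter fun i => b i = b m).card) :
    lam.toList < (blockPartition (Function.update b l (b m))).toList := by
  have hl0 := SergeevGroup.card_fibre_pos b l
  have hm0 := SergeevGroup.card_fibre_pos b m
  have himage : ∀ (c : Fin d → ℕ) (k : ℕ), k ∈ Finset.univ.image c ↔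
      0 < (Finset.univ.filter fun i => c i = k).card := by
    intro c k
    simp [Finset.card_pos, Finset.Nonempty]
  have hset : ∀ s, (Finset.univ.filter fun i => b i = b m).card < s →
      ((Finset.univ.image (Function.update b l (b m))).filter fun k =>
        s = (Finset.univ.filter fun i => Function.update b l (b m) i = k).card) =
      (if s = (Finset.univ.filter fun i => b i = b m).card + 1 then {b m} else ∅) ∪
        ((Finset.univ.image b).filter fun k =>
        s = (Finset.univ.filter fun i => b i = k).card) := by
    intro s hs
    ext k
    rw [Finset.mem_union, Finset.mem_filter, Finset.mem_filter, himage, himage,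
      card_fibre_update b h]
    have : k ∈ (if s = (Finset.univ.filter fun i => b i = b m).card + 1 then {b m} else ∅ :
        Finset ℕ) ↔ s = (Finset.univ.filter fun i => b i = b m).card + 1 ∧ k = b m := by
      split_ifs with hs'
      · simp [hs']
      · simp [hs']
    rw [this]
    split_ifs with h1 h2
    · subst h1
      constructor
      · rintro ⟨-, h'⟩; exact Or.inl ⟨h', rfl⟩
      · rintro (⟨h', -⟩ | ⟨-, h'⟩) <;> omega
    · subst h2
      constructor
      · rintro ⟨-, h'⟩; omega
      · rintro (⟨-, h'⟩ | ⟨-, h'⟩)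
        · exact absurd h' h
        · omega
    · tauto
  have hnot : b m ∉ (Finset.univ.image b).filter fun k =>
      (Finset.univ.filter fun i => b i = b m).card + 1 =
        (Finset.univ.filter fun i => b i = k).card := by
    intro hm
    have := (Finset.mem_filter.mp hm).2
    omega
  refine List.lt_of_count_lt (t := (Finset.univ.filter fun i => b i = b m).card + 1)
    (Multiset.pairwise_sort _ _) (Multiset.pairwise_sort _ _) (fun s hs => ?_) ?_
  · rw [Nat.Partition.count_toList, Nat.Partition.count_toList, ← hb]
    change _ = (blockSizes _).count s
    rw [count_blockSizes, count_blockSizes, hset s (by omega), if_neg (by omega), Finset.empty_union]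
  · rw [Nat.Partition.count_toList, Nat.Partition.count_toList, ← hb]
    change _ < (blockSizes _).count _
    rw [count_blockSizes, count_blockSizes, hset _ (by omega), if_pos rfl, Finset.singleton_union,
      Finset.card_insert_of_notMem hnot]
    omega

open SergeevGroup in
/-- In the module indexed by `lam` there are no invariants of raised Young subgroups. -/
theorem IsIrreducibleOfIndex.youngInvariants_update_eq_bot {M : SpinSupermodule d V}
    {lam : d.Partition} (hM : M.IsIrreducibleOfIndex lam) {b : Fin d → ℕ}
    (hb : blockSizes b = lam.parts) {l m : Fin d} (h : b l ≠ b m)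
    (hcard : (Finset.univ.filter fun i => b i = b l).card ≤
      (Finset.univ.filter fun i => b i = b m).card) :
    youngInvariants M.rho (Function.update b l (b m)) = ⊥ := by
  rw [Submodule.eq_bot_iff]
  intro v hv
  by_contra hv0
  exact absurd (hM.2.2 (blockPartition (Function.update b l (b m))) ⟨_, rfl, v, hv0, hv⟩)
    (not_le_of_gt (toList_lt_blockPartition_update hb h hcard))

end SpinSupermodule

section CliffordModule

variable {E : Type*} [AddCommGroup E] [Module ℂ E]

/-- The operators `h_0, …, h_{n-1}` are anticommuting involutions. -/
structure IsCliffordFamily (h : ℕ → E →ₗ[ℂ] E) (n : ℕ) : Prop where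
  sq : ∀ j < n, ∀ x, h j (h j x) = x
  anti : ∀ i < n, ∀ j < n, i ≠ j → ∀ x, h i (h j x) = -h j (h i x)

/-- The involution `√-1 h_{2r} h_{2r+1}`. -/
noncomputable def cliffordPair (h : ℕ → E →ₗ[ℂ] E) (r : ℕ) : E →ₗ[ℂ] E :=
  Complex.I • (h (2 * r) ∘ₗ h (2 * r + 1))

theorem cliffordPair_apply (h : ℕ → E →ₗ[ℂ] E) (r : ℕ) (x : E) :
    cliffordPair h r x = Complex.I • h (2 * r) (h (2 * r + 1) x) := rfl

variable {h : ℕ → E →ₗ[ℂ] E} {n : ℕ}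

namespace IsCliffordFamily

theorem cliffordPair_comm (hh : IsCliffordFamily h n) {r j : ℕ} (hr : 2 * r + 1 < n) (hj : j < n)
    (h₁ : j ≠ 2 * r) (h₂ : j ≠ 2 * r + 1) (x : E) :
    cliffordPair h r (h j x) = h j (cliffordPair h r x) := by
  rw [cliffordPair_apply, cliffordPair_apply, map_smul, hh.anti (2 * r + 1) hr j hj h₂.symm,
    map_neg, hh.anti (2 * r) (by omega) j hj h₁.symm, neg_neg]

theorem cliffordPair_anti (hh : IsCliffordFamily h n) {r : ℕ} (hr : 2 * r + 1 < n) (x : E) :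
    cliffordPair h r (h (2 * r) x) = -h (2 * r) (cliffordPair h r x) := by
  rw [cliffordPair_apply, cliffordPair_apply, map_smul,
    hh.anti (2 * r + 1) hr (2 * r) (by omega) (by omega), map_neg, smul_neg]

theorem cliffordPair_sq (hh : IsCliffordFamily h n) {r : ℕ} (hr : 2 * r + 1 < n) (x : E) :
    cliffordPair h r (cliffordPair h r x) = x := by
  rw [cliffordPair_apply, cliffordPair_apply, map_smul, map_smul,
    hh.anti (2 * r + 1) hr (2 * r) (by omega) (by omega), map_neg, hh.sq _ (by omega),
    hh.sq _ hr, smul_smul, Complex.I_mul_I, smul_neg, neg_one_smul, neg_neg]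

theorem cliffordPair_cliffordPair (hh : IsCliffordFamily h n) {r s : ℕ} (hr : 2 * r + 1 < n)
    (hs : 2 * s + 1 < n) (hrs : r ≠ s) (x : E) :
    cliffordPair h r (cliffordPair h s x) = cliffordPair h s (cliffordPair h r x) := by
  rw [cliffordPair_apply h s, cliffordPair_apply h s, map_smul,
    hh.cliffordPair_comm hr (by omega) (by omega) (by omega),
    hh.cliffordPair_comm hr (by omega) (by omega) (by omega)]

theorem mem_stableSpan_succ (hh : IsCliffordFamily h n) {r : ℕ} (hr : 2 * r + 1 < n) {u x : E}
    (hu : cliffordPair h r u = u) (hx : cliffordPair h r x = x)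
    (hmem : x ∈ stableSpan h (Set.Ico (2 * r) n) u) :
    x ∈ stableSpan h (Set.Ico (2 * r + 2) n) u := by
  set Y := stableSpan h (Set.Ico (2 * r + 2) n) u with hY
  have hfix : ∀ y ∈ Y, cliffordPair h r y = y := by
    have : Y ≤ LinearMap.eqLocus (cliffordPair h r) LinearMap.id := by
      refine stableSpan_le hu fun j hj y hy => ?_
      change cliffordPair h r (h j y) = h j y
      have hy : cliffordPair h r y = y := hy
      rw [hh.cliffordPair_comm hr hj.2 (by have := hj.1; omega) (by have := hj.1; omega), hy]
    exact fun y hy => this hy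
  have hodd : ∀ y ∈ Y, h (2 * r + 1) y = -(Complex.I • h (2 * r) y) := by
    intro y hy
    have h1 := congrArg (fun z => Complex.I • h (2 * r) z) (hfix y hy)
    simp only [cliffordPair_apply, map_smul] at h1
    rw [hh.sq _ (by omega), smul_smul, Complex.I_mul_I, neg_one_smul] at h1
    rw [← h1, neg_neg]
  have hle : stableSpan h (Set.Ico (2 * r) n) u ≤ Y ⊔ Y.map (h (2 * r)) := by
    refine stableSpan_le (Submodule.mem_sup_left mem_stableSpan_self) fun j hj z hz => ?_
    obtain ⟨y, hy, _, ⟨y', hy', rfl⟩, rfl⟩ := Submodule.mem_sup.mp hz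
    rw [map_add]
    by_cases h0 : j = 2 * r
    · subst h0
      rw [hh.sq _ hj.2, add_comm]
      exact Submodule.add_mem_sup hy' (Submodule.mem_map_of_mem hy)
    by_cases h1 : j = 2 * r + 1
    · subst h1
      rw [hodd y hy, hh.anti _ hr (2 * r) (by omega) (by omega), hodd y' hy', map_neg, map_smul,
        hh.sq _ (by omega), neg_neg, add_comm, ← smul_neg, ← map_neg]
      rw [← map_smul]
      exact Submodule.add_mem_sup (Y.smul_mem _ hy')
        (Submodule.mem_map_of_mem (Y.smul_mem _ (Y.neg_mem hy)))
    · have hj' : j ∈ Set.Ico (2 * r + 2) n := ⟨by have := hj.1; omega, hj.2⟩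
      rw [hh.anti j hj.2 (2 * r) (by omega) h0, ← map_neg]
      exact Submodule.add_mem_sup (apply_mem_stableSpan hj' hy)
        (Submodule.mem_map_of_mem (Y.neg_mem (apply_mem_stableSpan hj' hy')))
  obtain ⟨y, hy, _, ⟨y', hy', rfl⟩, rfl⟩ := Submodule.mem_sup.mp (hle hmem)
  rw [map_add, hfix y hy, hh.cliffordPair_anti hr, hfix y' hy', add_right_inj] at hx
  rw [CliffordGroup.mem_of_eq_neg (P := ⊥) hx.symm, add_zero]
  exact hy

theorem mem_stableSpan_Ico (hh : IsCliffordFamily h n) {u x : E}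
    (hu : ∀ r, 2 * r + 1 < n → cliffordPair h r u = u)
    (hx : ∀ r, 2 * r + 1 < n → cliffordPair h r x = x)
    (hmem : x ∈ stableSpan h (Set.Ico 0 n) u) :
    ∀ r, 2 * r ≤ n → x ∈ stableSpan h (Set.Ico (2 * r) n) u
  | 0, _ => hmem
  | r + 1, hr => hh.mem_stableSpan_succ (by omega) (hu r (by omega)) (hx r (by omega))
      (mem_stableSpan_Ico hh hu hx hmem r (by omega))

/-- In a cyclic module of an even Clifford algebra the vectors fixed by the involutions form a
line. -/
theorem exists_eq_smul_of_even (hh : IsCliffordFamily h n) (hn : Even n) {u x : E}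
    (hu : ∀ r, 2 * r + 1 < n → cliffordPair h r u = u)
    (hx : ∀ r, 2 * r + 1 < n → cliffordPair h r x = x)
    (hmem : x ∈ stableSpan h (Set.Ico 0 n) u) : ∃ a : ℂ, x = a • u := by
  obtain ⟨m, rfl⟩ := hn
  have h1 := hh.mem_stableSpan_Ico hu hx hmem m (by omega)
  have h2 : stableSpan h (Set.Ico (2 * m) (m + m)) u ≤ Submodule.span ℂ {u} :=
    stableSpan_le (Submodule.mem_span_singleton_self u) fun j hj => by
      have := hj.1; have := hj.2; omega
  obtain ⟨a, ha⟩ := Submodule.mem_span_singleton.mp (h2 h1)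
  exact ⟨a, ha.symm⟩

/-- In a cyclic module of an odd Clifford algebra the vectors fixed by the involutions form a
plane. -/
theorem exists_eq_smul_add_of_odd (hh : IsCliffordFamily h n) (hn : Odd n) {u x : E}
    (hu : ∀ r, 2 * r + 1 < n → cliffordPair h r u = u)
    (hx : ∀ r, 2 * r + 1 < n → cliffordPair h r x = x)
    (hmem : x ∈ stableSpan h (Set.Ico 0 n) u) :
    ∃ a a' : ℂ, x = a • u + a' • h (n - 1) u := by
  obtain ⟨m, rfl⟩ := hn
  have h1 := hh.mem_stableSpan_Ico hu hx hmem m (by omega)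
  have h2 : stableSpan h (Set.Ico (2 * m) (2 * m + 1)) u ≤
      Submodule.span ℂ {u, h (2 * m) u} := by
    refine stableSpan_le (Submodule.subset_span (by simp)) fun j hj z hz => ?_
    obtain rfl : j = 2 * m := by have := hj.1; have := hj.2; omega
    obtain ⟨a, a', rfl⟩ := Submodule.mem_span_pair.mp hz
    rw [map_add, map_smul, map_smul, hh.sq _ (by omega)]
    exact Submodule.mem_span_pair.mpr ⟨a', a, add_comm _ _⟩
  obtain ⟨a, a', ha⟩ := Submodule.mem_span_pair.mp (h2 h1)
  exact ⟨a, a', ha.symm⟩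

/-- A nonzero graded Clifford module has a nonzero homogeneous vector that is fixed by all the
involutions. -/
theorem exists_fixed (hh : IsCliffordFamily h n) {G : ZMod 2 → Submodule ℂ E}
    (hG : ∀ j < n, ∀ i, ∀ x ∈ G i, h j x ∈ G (i + 1)) {i : ZMod 2} {v : E} (hv : v ∈ G i)
    (hv0 : v ≠ 0) :
    ∃ i, ∃ u ∈ G i, u ≠ 0 ∧ ∀ r, 2 * r + 1 < n → cliffordPair h r u = u := by
  suffices H : ∀ m, ∃ i, ∃ u ∈ G i, u ≠ 0 ∧
      ∀ r, r < m → 2 * r + 1 < n → cliffordPair h r u = u by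
    obtain ⟨i, u, hu, hu0, H⟩ := H n
    exact ⟨i, u, hu, hu0, fun r hr => H r (by omega) hr⟩
  intro m
  induction m with
  | zero => exact ⟨i, v, hv, hv0, fun r hr => absurd hr (Nat.not_lt_zero r)⟩
  | succ m ih =>
    obtain ⟨i, u, hu, hu0, hfix⟩ := ih
    by_cases hm : 2 * m + 1 < n
    swap
    · refine ⟨i, u, hu, hu0, fun r hr hrn => hfix r ?_ hrn⟩
      omega
    by_cases hz : u + cliffordPair h m u = 0
    · have hzu : cliffordPair h m u = -u := (neg_eq_of_add_eq_zero_right hz).symm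
      refine ⟨i + 1, h (2 * m) u, hG _ (by omega) _ _ hu, fun h0 => hu0 ?_, fun r hr hrn => ?_⟩
      · rw [← hh.sq (2 * m) (by omega) u, h0, map_zero]
      · by_cases hrm : r = m
        · rw [hrm, hh.cliffordPair_anti hm, hzu, map_neg, neg_neg]
        · rw [hh.cliffordPair_comm hrn (by omega) (by omega) (by omega), hfix r (by omega) hrn]
    · refine ⟨i, _, (G i).add_mem hu ?_, hz, fun r hr hrn => ?_⟩
      · have h2 : i + 1 + 1 = i := by
          rw [add_assoc, CharTwo.add_self_eq_zero, add_zero]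
        have := hG (2 * m) (by omega) _ _ (hG (2 * m + 1) hm _ _ hu)
        rw [h2] at this
        exact (G i).smul_mem _ this
      · by_cases hrm : r = m
        · rw [hrm, map_add, hh.cliffordPair_sq hm, add_comm]
        · rw [map_add, hh.cliffordPair_cliffordPair hrn hm hrm, hfix r (by omega) hrn]

end IsCliffordFamily

end CliffordModule

theorem zmod_two_eq_zero_or_one (s : ZMod 2) : s = 0 ∨ s = 1 := by
  revert s
  decide

/-- The sign `(-1)^s`. -/
def zsign (s : ZMod 2) : ℂ := if s = 0 then 1 else -1

theorem zsign_add (s t : ZMod 2) : zsign (s + t) = zsign s * zsign t := by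
  obtain rfl | rfl : s = 0 ∨ s = 1 := zmod_two_eq_zero_or_one s
  · simp [zsign]
  obtain rfl | rfl : t = 0 ∨ t = 1 := zmod_two_eq_zero_or_one t
  · simp [zsign]
  · simp [zsign, CharTwo.add_self_eq_zero]

theorem zsign_mul_self (s : ZMod 2) : zsign s * zsign s = 1 := by
  rw [← zsign_add, CharTwo.add_self_eq_zero, zsign, if_pos rfl]

namespace SpinSupermodule

variable {d : ℕ} {V W : Type*} [AddCommGroup V] [Module ℂ V] [AddCommGroup W] [Module ℂ W]

theorem exists_eq_add (M : SpinSupermodule d V) (v : V) :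
    ∃ v₀ ∈ M.gr 0, ∃ v₁ ∈ M.gr 1, v = v₀ + v₁ := by
  have : v ∈ M.gr 0 ⊔ M.gr 1 := by rw [M.isCompl_gr.sup_eq_top]; trivial
  obtain ⟨v₀, h₀, v₁, h₁, h⟩ := Submodule.mem_sup.mp this
  exact ⟨v₀, h₀, v₁, h₁, h.symm⟩

theorem eq_zero_of_mem_of_mem (M : SpinSupermodule d V) {i : ZMod 2} {v : V} (h : v ∈ M.gr i)
    (h' : v ∈ M.gr (i + 1)) : v = 0 := by
  have hd := Submodule.disjoint_def.mp M.isCompl_gr.disjoint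
  obtain rfl | rfl : i = 0 ∨ i = 1 := zmod_two_eq_zero_or_one i
  · exact hd v h h'
  · exact hd v h' h

/-- The grading involution: `1` on `V_0` and `-1` on `V_1`. -/
noncomputable def grInv (M : SpinSupermodule d V) : V →ₗ[ℂ] V :=
  (M.gr 0).projection (M.gr 1) M.isCompl_gr - (M.gr 1).projection (M.gr 0) M.isCompl_gr.symm

theorem grInv_of_mem (M : SpinSupermodule d V) {i : ZMod 2} {v : V} (h : v ∈ M.gr i) :
    M.grInv v = zsign i • v := by
  obtain rfl | rfl : i = 0 ∨ i = 1 := zmod_two_eq_zero_or_one i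
  · rw [grInv, LinearMap.sub_apply, Submodule.projection_apply_of_mem_left _ h,
      Submodule.projection_apply_of_mem_right _ h, zsign, if_pos rfl, sub_zero, one_smul]
  · rw [grInv, LinearMap.sub_apply, Submodule.projection_apply_of_mem_left _ h,
      Submodule.projection_apply_of_mem_right _ h, zsign, if_neg one_ne_zero, zero_sub,
      neg_one_smul]

theorem grInv_grInv (M : SpinSupermodule d V) (v : V) : M.grInv (M.grInv v) = v := by
  obtain ⟨v₀, h₀, v₁, h₁, rfl⟩ := M.exists_eq_add v
  simp only [map_add, M.grInv_of_mem h₀, M.grInv_of_mem h₁, map_smul, smul_smul, zsign_mul_self,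
    one_smul]

theorem grInv_rho (M : SpinSupermodule d V) (x : SergeevGroup d) (v : V) :
    M.grInv (M.rho x v) = zsign x.deg • M.rho x (M.grInv v) := by
  obtain ⟨v₀, h₀, v₁, h₁, rfl⟩ := M.exists_eq_add v
  simp only [map_add, M.grInv_of_mem h₀, M.grInv_of_mem h₁, map_smul, smul_add, smul_smul,
    M.grInv_of_mem (M.map_gr x _ _ h₀), M.grInv_of_mem (M.map_gr x _ _ h₁), zsign_add]
  rw [mul_comm (zsign 0), mul_comm (zsign 1)]

theorem add_grInv_mem (M : SpinSupermodule d V) (v : V) : v + M.grInv v ∈ M.gr 0 := by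
  obtain ⟨v₀, h₀, v₁, h₁, rfl⟩ := M.exists_eq_add v
  rw [map_add, M.grInv_of_mem h₀, M.grInv_of_mem h₁]
  have : v₀ + v₁ + (zsign 0 • v₀ + zsign 1 • v₁) = (2 : ℂ) • v₀ := by
    simp [zsign, two_smul]
    abel
  rw [this]
  exact Submodule.smul_mem _ _ h₀

theorem sub_grInv_mem (M : SpinSupermodule d V) (v : V) : v - M.grInv v ∈ M.gr 1 := by
  obtain ⟨v₀, h₀, v₁, h₁, rfl⟩ := M.exists_eq_add v
  rw [map_add, M.grInv_of_mem h₀, M.grInv_of_mem h₁]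
  have : v₀ + v₁ - (zsign 0 • v₀ + zsign 1 • v₁) = (2 : ℂ) • v₁ := by
    simp [zsign, two_smul]
  rw [this]
  exact Submodule.smul_mem _ _ h₁

theorem eq_half_add (M : SpinSupermodule d V) (v : V) :
    v = (2⁻¹ : ℂ) • (v + M.grInv v) + (2⁻¹ : ℂ) • (v - M.grInv v) := by
  rw [← smul_add, add_add_sub_cancel, ← two_smul ℂ v, smul_smul]
  norm_num

/-- An irreducible supermodule has no proper invariant subspace that is stable under the grading
involution. -/
theorem IsIrreducible.eq_bot_or_eq_top {M : SpinSupermodule d V} (hM : M.IsIrreducible)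
    (U : Submodule ℂ V) (hU : ∀ x, ∀ v ∈ U, M.rho x v ∈ U) (hg : ∀ v ∈ U, M.grInv v ∈ U) :
    U = ⊥ ∨ U = ⊤ := by
  refine hM.2 U hU (le_antisymm (fun v hv => ?_) (sup_le inf_le_left inf_le_left))
  rw [M.eq_half_add v]
  exact Submodule.add_mem_sup
    (Submodule.smul_mem _ _ ⟨U.add_mem hv (hg v hv), M.add_grInv_mem v⟩)
    (Submodule.smul_mem _ _ ⟨U.sub_mem hv (hg v hv), M.sub_grInv_mem v⟩)

/-- A nonzero homogeneous vector generates an irreducible supermodule. -/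
theorem IsIrreducible.span_eq_top {M : SpinSupermodule d V} (hM : M.IsIrreducible) {i : ZMod 2}
    {v : V} (hv : v ∈ M.gr i) (hv0 : v ≠ 0) :
    Submodule.span ℂ (Set.range fun x => M.rho x v) = ⊤ := by
  refine (hM.eq_bot_or_eq_top _ (fun x w hw => ?_) (fun w hw => ?_)).resolve_left fun h => hv0 ?_
  · have hle : Submodule.span ℂ (Set.range fun x => M.rho x v) ≤
        (Submodule.span ℂ (Set.range fun x => M.rho x v)).comap (M.rho x) := by
      rw [Submodule.span_le]
      rintro _ ⟨y, rfl⟩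
      refine Submodule.subset_span ⟨x * y, ?_⟩
      simp
    exact hle hw
  · have hle : Submodule.span ℂ (Set.range fun x => M.rho x v) ≤
        (Submodule.span ℂ (Set.range fun x => M.rho x v)).comap M.grInv := by
      rw [Submodule.span_le]
      rintro _ ⟨y, rfl⟩
      simp only [SetLike.mem_coe, Submodule.mem_comap, M.grInv_of_mem (M.map_gr y i v hv)]
      exact Submodule.smul_mem _ _ (Submodule.subset_span ⟨y, rfl⟩)
    exact hle hw
  · have : M.rho 1 v ∈ Submodule.span ℂ (Set.range fun x => M.rho x v) :=
      Submodule.subset_span ⟨1, rfl⟩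
    rwa [h, Submodule.mem_bot, map_one, Module.End.one_apply] at this

/-- Schur's lemma for even operators. -/
theorem IsIrreducible.exists_eq_smul_id [FiniteDimensional ℂ V] {M : SpinSupermodule d V}
    (hM : M.IsIrreducible) (T : V →ₗ[ℂ] V) (hT : ∀ x v, T (M.rho x v) = M.rho x (T v))
    (hg : ∀ v, T (M.grInv v) = M.grInv (T v)) : ∃ c : ℂ, T = c • LinearMap.id := by
  have := hM.1
  obtain ⟨c, hc⟩ := Module.End.exists_eigenvalue T
  refine ⟨c, ?_⟩
  -- The eigenspace is invariant and graded because `T` commutes with both the group and the grading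
  -- involution.
  have htop : Module.End.eigenspace T c = ⊤ := by
    refine (hM.eq_bot_or_eq_top _ (fun x v hv => ?_) (fun v hv => ?_)).resolve_left hc
    · rw [Module.End.mem_eigenspace_iff] at hv ⊢
      rw [hT, hv, map_smul]
    · rw [Module.End.mem_eigenspace_iff] at hv ⊢
      rw [hg, hv, map_smul]
  ext v
  have : v ∈ Module.End.eigenspace T c := by rw [htop]; trivial
  exact Module.End.mem_eigenspace_iff.mp this

/-- A homogeneous intertwiner of irreducible supermodules is zero or bijective. -/
theorem IsIrreducible.bijective_of_ne_zero {M : SpinSupermodule d V} {N : SpinSupermodule d W}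
    (hM : M.IsIrreducible) (hN : N.IsIrreducible) {f : V →ₗ[ℂ] W}
    (hf : ∀ x v, f (M.rho x v) = N.rho x (f v)) {s : ℂ}
    (hg : ∀ v, N.grInv (f v) = s • f (M.grInv v)) (hs : s ≠ 0) (h0 : f ≠ 0) :
    Function.Bijective f := by
  constructor
  · rw [← LinearMap.ker_eq_bot]
    refine (hM.eq_bot_or_eq_top _ (fun x v hv => ?_) (fun v hv => ?_)).resolve_right
      fun h => h0 (LinearMap.ker_eq_top.mp h)
    · rw [LinearMap.mem_ker] at hv ⊢
      rw [hf, hv, map_zero]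
    · rw [LinearMap.mem_ker] at hv ⊢
      have h1 := hg v
      rw [hv, map_zero] at h1
      exact (smul_eq_zero.mp h1.symm).resolve_left hs
  · rw [← LinearMap.range_eq_top]
    refine (hN.eq_bot_or_eq_top _ ?_ ?_).resolve_left
      fun h => h0 (LinearMap.range_eq_bot.mp h)
    · rintro x _ ⟨v, rfl⟩
      exact ⟨M.rho x v, hf x v⟩
    · rintro _ ⟨v, rfl⟩
      exact ⟨s • M.grInv v, by rw [map_smul, hg]⟩

/-- If there is a nonzero intertwiner between two irreducible supermodules, then there is a
bijective one. -/
theorem IsIrreducible.exists_bijective {M : SpinSupermodule d V} {N : SpinSupermodule d W}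
    (hM : M.IsIrreducible) (hN : N.IsIrreducible)
    {f : V →ₗ[ℂ] W} (hf : ∀ x v, f (M.rho x v) = N.rho x (f v)) (h0 : f ≠ 0) :
    ∃ g : V →ₗ[ℂ] W, (∀ x v, g (M.rho x v) = N.rho x (g v)) ∧ Function.Bijective g := by
  -- `f + F` and `f - F` are twice the even and the odd part of `f`, and they cannot both vanish.
  set F : V →ₗ[ℂ] W := N.grInv ∘ₗ f ∘ₗ M.grInv with hF
  have hFx : ∀ x v, F (M.rho x v) = N.rho x (F v) := by
    intro x v
    simp only [hF, LinearMap.comp_apply]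
    rw [M.grInv_rho, map_smul, map_smul, hf, N.grInv_rho, smul_smul, zsign_mul_self, one_smul]
  have hg₁ : ∀ v, N.grInv ((f + F) v) = (1 : ℂ) • (f + F) (M.grInv v) := by
    intro v
    simp only [hF, LinearMap.add_apply, LinearMap.comp_apply, map_add, grInv_grInv, one_smul]
    exact add_comm _ _
  have hg₂ : ∀ v, N.grInv ((f - F) v) = (-1 : ℂ) • (f - F) (M.grInv v) := by
    intro v
    simp only [hF, LinearMap.sub_apply, LinearMap.comp_apply, map_sub, grInv_grInv, neg_one_smul,
      neg_sub]
  by_cases h : f + F = 0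
  · have h' : f - F ≠ 0 := by
      intro h'
      refine h0 ?_
      have h2 : (2 : ℂ) • f = 0 := by
        rw [two_smul, show f + f = (f + F) + (f - F) by abel, h, h', add_zero]
      exact (smul_eq_zero.mp h2).resolve_left two_ne_zero
    have hx : ∀ x v, (f - F) (M.rho x v) = N.rho x ((f - F) v) := fun x v => by
      rw [LinearMap.sub_apply, hf, hFx, LinearMap.sub_apply, map_sub]
    exact ⟨f - F, hx, hM.bijective_of_ne_zero hN hx hg₂ (by norm_num) h'⟩
  · have hx : ∀ x v, (f + F) (M.rho x v) = N.rho x ((f + F) v) := fun x v => by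
      rw [LinearMap.add_apply, hf, hFx, LinearMap.add_apply, map_add]
    exact ⟨f + F, hx, hM.bijective_of_ne_zero hN hx hg₁ one_ne_zero h⟩

theorem HasWeight.of_injective {M : SpinSupermodule d V} {N : SpinSupermodule d W}
    {f : V →ₗ[ℂ] W} (hf : ∀ x v, f (M.rho x v) = N.rho x (f v)) (hinj : Function.Injective f)
    {γ : d.Partition} (h : M.HasWeight γ) : N.HasWeight γ := by
  obtain ⟨b, hb, v, hv0, hv⟩ := h
  exact ⟨b, hb, f v, fun h => hv0 (hinj (h.trans (map_zero f).symm)),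
    fun g hg => by rw [← hf, hv g hg]⟩

theorem IsIrreducibleOfIndex.index_le {M : SpinSupermodule d V} {N : SpinSupermodule d W}
    {lam mu : d.Partition} (hM : M.IsIrreducibleOfIndex lam) (hN : N.IsIrreducibleOfIndex mu)
    {f : V →ₗ[ℂ] W} (hf : ∀ x v, f (M.rho x v) = N.rho x (f v)) (hinj : Function.Injective f) :
    lam.toList ≤ mu.toList :=
  hN.2.2 lam (hM.2.1.of_injective hf hinj)

/-- Irreducible supermodules with a nonzero intertwiner have the same index. -/
theorem IsIrreducibleOfIndex.index_eq {M : SpinSupermodule d V} {N : SpinSupermodule d W}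
    {lam mu : d.Partition} (hM : M.IsIrreducibleOfIndex lam) (hN : N.IsIrreducibleOfIndex mu)
    {f : V →ₗ[ℂ] W} (hf : ∀ x v, f (M.rho x v) = N.rho x (f v)) (h0 : f ≠ 0) : lam = mu := by
  obtain ⟨g, hg, hbij⟩ := hM.1.exists_bijective hN.1 hf h0
  have hle := hM.index_le hN hg hbij.1
  let e := LinearEquiv.ofBijective g hbij
  have hge := hN.index_le hM (f := e.symm.toLinearMap) (fun x w => by
    have h1 : g (e.symm w) = w := e.apply_symm_apply w
    apply hbij.1
    change g (e.symm (N.rho x w)) = g (M.rho x (e.symm w))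
    rw [hg, h1]
    exact e.apply_symm_apply _) e.symm.injective
  have := le_antisymm hle hge
  ext1
  rw [← Multiset.sort_eq lam.parts (· ≥ ·), ← Multiset.sort_eq mu.parts (· ≥ ·)]
  exact congrArg _ this

end SpinSupermodule

/-! ### Enumeration and conjugacy of block decompositions -/

/-- Indexing by `ℕ` lets the blocks be paired as `2 * r`, `2 * r + 1`; the values from `s.card` on
play no role. -/
theorem Finset.exists_enumeration {α : Type*} [Inhabited α] (s : Finset α) :
    ∃ e : ℕ → α, (∀ j < s.card, e j ∈ s) ∧
      (∀ i < s.card, ∀ j < s.card, i ≠ j → e i ≠ e j) ∧ ∀ k ∈ s, ∃ j < s.card, e j = k := by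
  refine ⟨fun j => if h : j < s.card then s.equivFin.symm ⟨j, h⟩ else default, ?_, ?_, ?_⟩
  · intro j hj
    simp only [hj, dif_pos]
    exact (s.equivFin.symm ⟨j, hj⟩).2
  · intro i hi j hj hij h
    simp only [hi, hj, dif_pos] at h
    have := s.equivFin.symm.injective (Subtype.ext h)
    exact hij (congrArg Fin.val this)
  · intro k hk
    refine ⟨s.equivFin ⟨k, hk⟩, (s.equivFin ⟨k, hk⟩).2, ?_⟩
    simp

namespace SpinSupermodule

variable {d : ℕ}

/-- Decompositions into blocks of the same sizes are conjugate. -/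
theorem exists_perm_of_blockSizes_eq {b b' : Fin d → ℕ} (h : blockSizes b = blockSizes b') :
    ∃ (g : Equiv.Perm (Fin d)) (τ : ℕ → ℕ), ∀ i, b' (g i) = τ (b i) := by
  let f : Finset.univ.image b → ℕ := fun k => (Finset.univ.filter fun i => b i = k).card
  let f' : Finset.univ.image b' → ℕ := fun k => (Finset.univ.filter fun i => b' i = k).card
  have hcount : ∀ (c : Fin d → ℕ) (n : ℕ),
      Nat.card {k : {k // k ∈ Finset.univ.image c} //
        (Finset.univ.filter fun i => c i = k).card = n} = (blockSizes c).count n := by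
    intro c n
    rw [count_blockSizes, ← Nat.card_eq_finsetCard]
    refine Nat.card_congr ((Equiv.subtypeSubtypeEquivSubtypeInter _
      (fun k => (Finset.univ.filter fun i => c i = k).card = n)).trans
      (Equiv.subtypeEquivRight fun k => ?_))
    rw [Finset.mem_filter, eq_comm (a := n)]
  -- Equal multisets of sizes allow the blocks of `b` and `b'` to be matched size by size.
  let eA : Finset.univ.image b ≃ Finset.univ.image b' := Equiv.ofFiberEquiv (f := f) (g := f') fun n =>
    (Finite.equivFin _).trans ((finCongr ((hcount b n).trans
      ((congrArg _ h).trans (hcount b' n).symm))).trans (Finite.equivFin _).symm)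
  have heA : ∀ k, f' (eA k) = f k := fun k => Equiv.ofFiberEquiv_map _ k
  -- `φ` labels a letter by the partner of its `b`-block, `φ'` by its own `b'`-block. Their fibres
  -- have equal sizes, so a permutation of the letters carries one labelling to the other.
  let φ : Fin d → Finset.univ.image b' := fun i => eA ⟨b i, Finset.mem_image_of_mem _ (Finset.mem_univ i)⟩
  let φ' : Fin d → Finset.univ.image b' := fun i => ⟨b' i, Finset.mem_image_of_mem _ (Finset.mem_univ i)⟩
  have hcard : ∀ k : Finset.univ.image b', Fintype.card {i // φ i = k} = Fintype.card {i // φ' i = k} := by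
    intro k
    obtain ⟨k, rfl⟩ := eA.surjective k
    have h1 : Fintype.card {i // φ i = eA k} = f k := by
      rw [Fintype.card_subtype]
      refine congrArg _ (Finset.filter_congr fun i _ => ?_)
      rw [eA.apply_eq_iff_eq, Subtype.ext_iff]
    have h2 : Fintype.card {i // φ' i = eA k} = f' (eA k) := by
      rw [Fintype.card_subtype]
      refine congrArg _ (Finset.filter_congr fun i _ => ?_)
      rw [Subtype.ext_iff]
    rw [h1, h2, heA]
  let g : Equiv.Perm (Fin d) := Equiv.ofFiberEquiv (f := φ) (g := φ') fun k =>
    Fintype.equivOfCardEq (hcard k)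
  -- The value `0` is a dummy for labels that `b` does not take.
  refine ⟨g, fun k => if hk : k ∈ Finset.univ.image b then eA ⟨k, hk⟩ else 0, fun i => ?_⟩
  have hi : b i ∈ Finset.univ.image b := Finset.mem_image_of_mem _ (Finset.mem_univ i)
  simp only [hi, dif_pos]
  exact congrArg Subtype.val (Equiv.ofFiberEquiv_map (f := φ) (g := φ') _ i)

end SpinSupermodule

/-! ### Clifford relations for the block sums, and direct sums of representations -/

namespace SergeevGroup

variable {d : ℕ} {E F : Type*} [AddCommGroup E] [Module ℂ E] [AddCommGroup F] [Module ℂ F]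
  {ρ : Representation ℂ (SergeevGroup d) E} {σ : Representation ℂ (SergeevGroup d) F}
  {b : Fin d → ℕ}

open CliffordGroup (xi)

/-- Conjugation by `g` maps the Young subgroup of `b` into that of `b'`, so `pure g⁻¹` carries
invariants for `b'` to invariants for `b`. This allows two modules with the same weight to be
compared on one decomposition. -/
theorem youngInvariants_ne_bot_of_conj {b' : Fin d → ℕ} {g : Equiv.Perm (Fin d)} {τ : ℕ → ℕ}
    (hg : ∀ i, b' (g i) = τ (b i)) (h : youngInvariants ρ b' ≠ ⊥) : youngInvariants ρ b ≠ ⊥ := by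
  obtain ⟨v, hv, hv0⟩ := Submodule.exists_mem_ne_zero_of_ne_bot h
  refine (Submodule.ne_bot_iff _).mpr ⟨ρ (pure g⁻¹) v, fun k hk => ?_, fun h0 => hv0 ?_⟩
  · have h1 : k * g⁻¹ = g⁻¹ * (g * k * g⁻¹) := by group
    rw [rho_apply_apply, ← pure_mul, h1, pure_mul, ← rho_apply_apply, hv]
    intro i
    have h2 := hg (g⁻¹ i)
    rw [show g (g⁻¹ i) = i from g.apply_symm_apply i] at h2
    rw [Equiv.Perm.mul_apply, Equiv.Perm.mul_apply, hg, hk, h2]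
  · have h1 := congrArg (ρ (pure g)) h0
    rwa [rho_apply_apply, ← pure_mul, mul_inv_cancel, pure_one, map_one, Module.End.one_apply,
      map_zero] at h1

theorem rho_xi_xi (hε : ρ eps = -1) (i j : Fin d) (x : E) :
    ρ (cl (xi i)) (ρ (cl (xi j)) x) + ρ (cl (xi j)) (ρ (cl (xi i)) x) =
      if i = j then (2 : ℂ) • x else 0 := by
  rw [rho_apply_apply, rho_apply_apply, ← cl_mul, ← cl_mul]
  split_ifs with h
  · rw [h, CliffordGroup.xi_mul_self, cl_one, map_one, Module.End.one_apply, two_smul]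
  · have := rho_cl_eps_mul hε (xi j * xi i) 1 x
    rw [mul_one, mul_one] at this
    rw [CliffordGroup.xi_mul_xi h, this, neg_add_cancel]

/-- Distinct `ξ_i` anticommute, so only the diagonal terms `ξ_i² = 1` survive, and these occur only
within a single block. -/
theorem blockXi_add_blockXi (hε : ρ eps = -1) (k k' : ℕ) (x : E) :
    blockXi ρ b k (blockXi ρ b k' x) + blockXi ρ b k' (blockXi ρ b k x) =
      if k = k' then (2 * (Finset.univ.filter fun i => b i = k).card : ℂ) • x else 0 := by
  have h1 : ∀ k k', blockXi ρ b k (blockXi ρ b k' x) = ∑ i with b i = k, ∑ j with b j = k',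
      ρ (cl (xi i)) (ρ (cl (xi j)) x) := by
    intro k k'
    rw [blockXi_apply]
    refine Finset.sum_congr rfl fun i _ => ?_
    rw [blockXi_apply, map_sum]
  rw [h1, h1, Finset.sum_comm (s := Finset.univ.filter fun i => b i = k')]
  simp only [← Finset.sum_add_distrib, rho_xi_xi hε]
  split_ifs with h
  · subst h
    rw [Finset.sum_congr rfl fun i hi => by rw [Finset.sum_ite_eq, if_pos hi], Finset.sum_const,
      ← Nat.cast_smul_eq_nsmul ℂ, smul_smul, mul_comm]
  · refine Finset.sum_eq_zero fun i hi => Finset.sum_eq_zero fun j hj => if_neg ?_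
    rintro rfl
    exact h ((Finset.mem_filter.mp hi).2.symm.trans (Finset.mem_filter.mp hj).2)

/-- The normalized `ξ`-sums over the blocks `e 0, e 1, …`. -/
noncomputable def normXi (ρ : Representation ℂ (SergeevGroup d) E) (b : Fin d → ℕ) (e : ℕ → ℕ)
    (j : ℕ) : E →ₗ[ℂ] E :=
  ((√((Finset.univ.filter fun i => b i = e j).card : ℝ) : ℝ) : ℂ)⁻¹ • blockXi ρ b (e j)

/-- `e 0, e 1, …` lists the blocks of `b`. -/
structure IsBlockEnumeration (b : Fin d → ℕ) (e : ℕ → ℕ) (n : ℕ) : Prop where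
  mem : ∀ j < n, ∃ i, b i = e j
  inj : ∀ i < n, ∀ j < n, i ≠ j → e i ≠ e j
  surj : ∀ i, ∃ j < n, e j = b i

theorem exists_isBlockEnumeration (b : Fin d → ℕ) :
    ∃ e, IsBlockEnumeration b e (Finset.univ.image b).card := by
  obtain ⟨e, h1, h2, h3⟩ := (Finset.univ.image b).exists_enumeration
  refine ⟨e, fun j hj => ?_, h2, fun i => h3 _ (Finset.mem_image_of_mem _ (Finset.mem_univ i))⟩
  obtain ⟨i, -, hi⟩ := Finset.mem_image.mp (h1 j hj)
  exact ⟨i, hi⟩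

namespace IsBlockEnumeration

variable {e : ℕ → ℕ} {n : ℕ}

theorem card_ne_zero (he : IsBlockEnumeration b e n) {j : ℕ} (hj : j < n) :
    (Finset.univ.filter fun i => b i = e j).card ≠ 0 := by
  obtain ⟨i, hi⟩ := he.mem j hj
  rw [← hi]
  exact (card_fibre_pos b i).ne'

theorem sqrt_card_ne_zero (he : IsBlockEnumeration b e n) {j : ℕ} (hj : j < n) :
    ((√((Finset.univ.filter fun i => b i = e j).card : ℝ) : ℝ) : ℂ) ≠ 0 := by
  rw [Complex.ofReal_ne_zero, Real.sqrt_ne_zero (Nat.cast_nonneg _), Nat.cast_ne_zero]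
  exact he.card_ne_zero hj

theorem isCliffordFamily (he : IsBlockEnumeration b e n) (hε : ρ eps = -1) :
    IsCliffordFamily (normXi ρ b e) n where
  sq j hj x := by
    have h1 := blockXi_add_blockXi (b := b) hε (e j) (e j) x
    rw [if_pos rfl, ← two_smul ℂ, mul_smul] at h1
    have h2 := smul_right_injective E (two_ne_zero (α := ℂ)) h1
    have h3 : ((√((Finset.univ.filter fun i => b i = e j).card : ℝ) : ℝ) : ℂ) *
        ((√((Finset.univ.filter fun i => b i = e j).card : ℝ) : ℝ) : ℂ) =
        ((Finset.univ.filter fun i => b i = e j).card : ℂ) := by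
      rw [← Complex.ofReal_mul, Real.mul_self_sqrt (Nat.cast_nonneg _), Complex.ofReal_natCast]
    have h4 : ((Finset.univ.filter fun i => b i = e j).card : ℂ) ≠ 0 :=
      Nat.cast_ne_zero.mpr (he.card_ne_zero hj)
    simp only [normXi, LinearMap.smul_apply, map_smul]
    rw [h2, smul_smul, smul_smul, ← mul_inv, h3, inv_mul_cancel₀ h4, one_smul]
  anti i hi j hj hij x := by
    have h1 := blockXi_add_blockXi (b := b) hε (e i) (e j) x
    rw [if_neg (he.inj i hi j hj hij)] at h1
    simp only [normXi, LinearMap.smul_apply, map_smul]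
    rw [eq_neg_of_add_eq_zero_left h1, smul_neg, smul_neg, smul_smul, smul_smul, mul_comm]

/-- If `k` labels a block, its `blockXi` is a multiple of some `normXi`; for every other `k` it is
an empty sum. -/
theorem stableSpan_le (he : IsBlockEnumeration b e n) (u : E) :
    stableSpan (blockXi ρ b) Set.univ u ≤ stableSpan (normXi ρ b e) (Set.Ico 0 n) u := by
  refine _root_.stableSpan_le mem_stableSpan_self fun k _ x hx => ?_
  by_cases hk : ∃ i, b i = k
  · obtain ⟨i, rfl⟩ := hk
    obtain ⟨j, hj, hji⟩ := he.surj i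
    have h1 : blockXi ρ b (b i) x =
        ((√((Finset.univ.filter fun i => b i = e j).card : ℝ) : ℝ) : ℂ) • normXi ρ b e j x := by
      rw [normXi, LinearMap.smul_apply, smul_smul, mul_inv_cancel₀ (he.sqrt_card_ne_zero hj),
        one_smul, hji]
    rw [h1]
    exact Submodule.smul_mem _ _ (apply_mem_stableSpan (Set.mem_Ico.mpr ⟨Nat.zero_le j, hj⟩) hx)
  · have h1 : (Finset.univ.filter fun i => b i = k) = ∅ :=
      Finset.filter_eq_empty_iff.mpr fun i _ hi => hk ⟨i, hi⟩
    rw [blockXi_apply, h1, Finset.sum_empty]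
    exact Submodule.zero_mem _

end IsBlockEnumeration

theorem normXi_mem_youngInvariants {e : ℕ → ℕ} (j : ℕ) {v : E} (hv : v ∈ youngInvariants ρ b) :
    normXi ρ b e j v ∈ youngInvariants ρ b :=
  Submodule.smul_mem _ _ (blockXi_mem_youngInvariants hv _)

/-- The graph argument of `exists_intertwiner` straightens vectors inside `V × W`, so the Young
invariants and the Clifford operators are needed componentwise for `ρ.prod σ`. -/
theorem prod_apply (x : SergeevGroup d) (v : E) (w : F) :
    ρ.prod σ x (v, w) = (ρ x v, σ x w) := rfl

theorem prod_mem_youngInvariants {v : E} {w : F} :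
    (v, w) ∈ youngInvariants (ρ.prod σ) b ↔ v ∈ youngInvariants ρ b ∧ w ∈ youngInvariants σ b := by
  simp only [mem_youngInvariants, prod_apply, Prod.mk.injEq]
  exact ⟨fun h => ⟨fun g hg => (h g hg).1, fun g hg => (h g hg).2⟩,
    fun h g hg => ⟨h.1 g hg, h.2 g hg⟩⟩

theorem youngInvariants_prod_eq_bot (h₁ : youngInvariants ρ b = ⊥) (h₂ : youngInvariants σ b = ⊥) :
    youngInvariants (ρ.prod σ) b = ⊥ := by
  rw [Submodule.eq_bot_iff]
  rintro ⟨v, w⟩ h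
  rw [prod_mem_youngInvariants, h₁, h₂, Submodule.mem_bot, Submodule.mem_bot] at h
  rw [h.1, h.2, Prod.mk_zero_zero]

theorem prod_eps (hρ : ρ eps = -1) (hσ : σ eps = -1) : ρ.prod σ eps = -1 := by
  ext1 <;> ext x <;> simp [hρ, hσ]

theorem normXi_prod (e : ℕ → ℕ) (j : ℕ) (v : E) (w : F) :
    normXi (ρ.prod σ) b e j (v, w) = (normXi ρ b e j v, normXi σ b e j w) := by
  simp only [normXi, LinearMap.smul_apply, blockXi_apply, prod_apply]
  refine Prod.ext ?_ ?_
  · rw [Prod.smul_fst, Prod.fst_sum]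
  · rw [Prod.smul_snd, Prod.snd_sum]

theorem cliffordPair_prod (e : ℕ → ℕ) (r : ℕ) (v : E) (w : F) :
    cliffordPair (normXi (ρ.prod σ) b e) r (v, w) =
      (cliffordPair (normXi ρ b e) r v, cliffordPair (normXi σ b e) r w) := by
  simp only [cliffordPair_apply, normXi_prod, Prod.smul_mk]

end SergeevGroup

/-! ### Extremal vectors and the dimension of the space of intertwiners -/

namespace SpinSupermodule

open SergeevGroup

variable {d : ℕ} {V W : Type*} [AddCommGroup V] [Module ℂ V] [AddCommGroup W] [Module ℂ W]
  {M : SpinSupermodule d V} {N : SpinSupermodule d W} {b : Fin d → ℕ} {e : ℕ → ℕ} {n : ℕ}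

theorem deg_pure (g : Equiv.Perm (Fin d)) : (SergeevGroup.pure g).deg = 0 :=
  Finset.sum_eq_zero fun _ _ => rfl

theorem deg_cl (c : CliffordGroup d) : (cl c).deg = c.parity := rfl

theorem normXi_mem_gr (M : SpinSupermodule d V) {i : ZMod 2} {v : V} (hv : v ∈ M.gr i) (j : ℕ) :
    normXi M.rho b e j v ∈ M.gr (i + 1) := by
  rw [normXi, LinearMap.smul_apply, blockXi_apply]
  refine Submodule.smul_mem _ _ (Submodule.sum_mem _ fun k _ => ?_)
  have := M.map_gr (cl (CliffordGroup.xi k)) i v hv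
  rwa [deg_cl, CliffordGroup.xi_parity] at this

/-- Pure permutations have degree 0 and so commute with the grading involution. Hence the
homogeneous components of an invariant are invariant. -/
theorem grInv_mem_youngInvariants (M : SpinSupermodule d V) {v : V}
    (hv : v ∈ youngInvariants M.rho b) : M.grInv v ∈ youngInvariants M.rho b := fun g hg => by
  have := M.grInv_rho (SergeevGroup.pure g) v
  rw [hv g hg, deg_pure, zsign, if_pos rfl, one_smul] at this
  exact this.symm

theorem exists_homogeneous_youngInvariants (M : SpinSupermodule d V)
    (h : youngInvariants M.rho b ≠ ⊥) :
    ∃ i, ∃ v ∈ M.gr i ⊓ youngInvariants M.rho b, v ≠ 0 := by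
  obtain ⟨v, hv, hv0⟩ := Submodule.exists_mem_ne_zero_of_ne_bot h
  have hg := M.grInv_mem_youngInvariants hv
  by_cases h0 : v + M.grInv v = 0
  · refine ⟨1, _, ⟨M.sub_grInv_mem v, Submodule.sub_mem _ hv hg⟩, fun h1 => hv0 ?_⟩
    rw [M.eq_half_add v, h0, h1, smul_zero, add_zero]
  · exact ⟨0, _, ⟨M.add_grInv_mem v, Submodule.add_mem _ hv hg⟩, h0⟩

/-- `v` is a homogeneous vector of degree `i` that is invariant under the Young subgroup and fixed
by the involutions attached to the pairs of blocks. -/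
structure IsExtremal (M : SpinSupermodule d V) (b : Fin d → ℕ) (e : ℕ → ℕ) (n : ℕ) (i : ZMod 2)
    (v : V) : Prop where
  mem_gr : v ∈ M.gr i
  mem_youngInvariants : v ∈ youngInvariants M.rho b
  fixed : ∀ r, 2 * r + 1 < n → cliffordPair (normXi M.rho b e) r v = v

/-- For odd `n` the last generator, of index `n - 1`, belongs to no pair and commutes with every
pair involution. It yields a second extremal vector, of the opposite degree. -/
theorem IsExtremal.normXi_last {i : ZMod 2} {v : V} (hv : M.IsExtremal b e n i v)
    (he : IsBlockEnumeration b e n) (hn : Odd n) :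
    M.IsExtremal b e n (i + 1) (normXi M.rho b e (n - 1) v) where
  mem_gr := M.normXi_mem_gr hv.mem_gr _
  mem_youngInvariants := normXi_mem_youngInvariants _ hv.mem_youngInvariants
  fixed r hr := by
    obtain ⟨m, rfl⟩ := hn
    rw [(he.isCliffordFamily M.rho_eps).cliffordPair_comm hr (by omega) (by omega) (by omega),
      hv.fixed r hr]

/-- The normalized block sums preserve the Young invariants and shift the degree, so `exists_fixed`
applies to the graded space of invariants. -/
theorem exists_isExtremal (M : SpinSupermodule d V) (he : IsBlockEnumeration b e n)
    (h : youngInvariants M.rho b ≠ ⊥) : ∃ i v, v ≠ 0 ∧ M.IsExtremal b e n i v := by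
  obtain ⟨i, v, hv, hv0⟩ := M.exists_homogeneous_youngInvariants h
  obtain ⟨j, u, hu, hu0, hfix⟩ := (he.isCliffordFamily M.rho_eps).exists_fixed
    (G := fun i => M.gr i ⊓ youngInvariants M.rho b)
    (fun j _ i x hx => ⟨M.normXi_mem_gr hx.1 j, normXi_mem_youngInvariants j hx.2⟩) hv hv0
  exact ⟨j, u, hu0, hu.1, hu.2, hfix⟩

/-- No raised Young subgroup has nonzero invariants. -/
def IsHighest (ρ : Representation ℂ (SergeevGroup d) V) (b : Fin d → ℕ) : Prop :=
  ∀ l m, b l ≠ b m → (Finset.univ.filter fun i => b i = b l).card ≤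
    (Finset.univ.filter fun i => b i = b m).card →
    youngInvariants ρ (Function.update b l (b m)) = ⊥

theorem mem_stableSpan_normXi {ρ : Representation ℂ (SergeevGroup d) V} (hε : ρ eps = -1)
    (hb : IsHighest ρ b) (he : IsBlockEnumeration b e n) {v w : V} (hv : v ∈ youngInvariants ρ b)
    (hw : w ∈ youngInvariants ρ b) (hwv : w ∈ Submodule.span ℂ (Set.range fun x => ρ x v)) :
    w ∈ stableSpan (normXi ρ b e) (Set.Ico 0 n) v :=
  he.stableSpan_le v (mem_stableSpan_of_mem_span hε hv hb hw hwv)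

/-- Straightening in `V × W` shows that `(0, w)` is a combination of `(v, w)` and, for odd `n`, of
its image `(h v, h w)` under the last generator `h`. In the first coordinate `v` and `h v` are
nonzero of opposite degrees, so both coefficients vanish. -/
theorem zero_eq_of_zero_mem_span (hbM : IsHighest M.rho b) (hbN : IsHighest N.rho b)
    (he : IsBlockEnumeration b e n) {i j : ZMod 2} {v : V} {w : W} (hv : M.IsExtremal b e n i v)
    (hv0 : v ≠ 0) (hw : N.IsExtremal b e n j w)
    (h : ((0 : V), w) ∈ Submodule.span ℂ (Set.range fun x => M.rho.prod N.rho x (v, w))) :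
    w = 0 := by
  have hε := prod_eps M.rho_eps N.rho_eps
  have hfam := he.isCliffordFamily hε
  have hmem := mem_stableSpan_normXi hε
    (fun l m h1 h2 => youngInvariants_prod_eq_bot (hbM l m h1 h2) (hbN l m h1 h2)) he
    (prod_mem_youngInvariants.mpr ⟨hv.mem_youngInvariants, hw.mem_youngInvariants⟩)
    (prod_mem_youngInvariants.mpr ⟨Submodule.zero_mem _, hw.mem_youngInvariants⟩) h
  have hu : ∀ r, 2 * r + 1 < n →
      cliffordPair (normXi (M.rho.prod N.rho) b e) r (v, w) = (v, w) := fun r hr => by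
    rw [cliffordPair_prod, hv.fixed r hr, hw.fixed r hr]
  have hx : ∀ r, 2 * r + 1 < n →
      cliffordPair (normXi (M.rho.prod N.rho) b e) r (0, w) = (0, w) := fun r hr => by
    rw [cliffordPair_prod, map_zero, hw.fixed r hr]
  rcases Nat.even_or_odd n with hn | hn
  · obtain ⟨a, ha⟩ := hfam.exists_eq_smul_of_even hn hu hx hmem
    rw [Prod.smul_mk, Prod.mk.injEq] at ha
    have ha0 : a = 0 := (smul_eq_zero.mp ha.1.symm).resolve_right hv0
    rw [ha.2, ha0, zero_smul]
  · obtain ⟨a, a', ha⟩ := hfam.exists_eq_smul_add_of_odd hn hu hx hmem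
    rw [normXi_prod, Prod.smul_mk, Prod.smul_mk, Prod.mk_add_mk, Prod.mk.injEq] at ha
    have h1 : a • v = 0 := by
      refine M.eq_zero_of_mem_of_mem (Submodule.smul_mem _ _ hv.mem_gr) ?_
      rw [eq_neg_of_add_eq_zero_left ha.1.symm]
      exact Submodule.neg_mem _ (Submodule.smul_mem _ _ (M.normXi_mem_gr hv.mem_gr _))
    have ha0 : a = 0 := (smul_eq_zero.mp h1).resolve_right hv0
    have h2 := ha.1
    rw [h1, zero_add] at h2
    have hn' : n - 1 < n := by
      obtain ⟨m, rfl⟩ := hn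
      omega
    have ha0' : a' = 0 := by
      refine (smul_eq_zero.mp h2.symm).resolve_right fun h3 => hv0 ?_
      rw [← (he.isCliffordFamily M.rho_eps).sq (n - 1) hn' v, h3, map_zero]
    rw [ha.2, ha0, ha0', zero_smul, zero_smul, add_zero]

/-- An extremal vector of `N` is the image of a given extremal vector of `M`. -/
theorem exists_intertwiner (hM : M.IsIrreducible) (hN : N.IsIrreducible)
    (hbM : IsHighest M.rho b) (hbN : IsHighest N.rho b)
    (he : IsBlockEnumeration b e n) {i j : ZMod 2} {v : V} {w : W} (hv : M.IsExtremal b e n i v)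
    (hv0 : v ≠ 0) (hw : N.IsExtremal b e n j w) :
    ∃ f : V →ₗ[ℂ] W, (∀ x u, f (M.rho x u) = N.rho x (f u)) ∧ f v = w := by
  by_cases hw0 : w = 0
  · exact ⟨0, by simp, hw0.symm⟩
  -- `X` turns out to be the graph of the intertwiner.
  set X := Submodule.span ℂ (Set.range fun x => M.rho.prod N.rho x (v, w)) with hX
  have hvw : (v, w) ∈ X := by
    have : M.rho.prod N.rho 1 (v, w) ∈ X := Submodule.subset_span ⟨1, rfl⟩
    rwa [map_one] at this
  have hXrho : ∀ x, ∀ u ∈ X, M.rho.prod N.rho x u ∈ X := by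
    intro x
    have hle : X ≤ X.comap (M.rho.prod N.rho x) := by
      rw [hX, Submodule.span_le]
      rintro _ ⟨y, rfl⟩
      refine Submodule.subset_span ⟨x * y, ?_⟩
      exact (rho_apply_apply x y _).symm
    exact fun u hu => hle hu
  -- `v` and `w` may have different degrees. Rescaling each grading involution so that it fixes `v`,
  -- respectively `w`, gives an operator on `V × W` that preserves `X`.
  have hXgr : ∀ u ∈ X, (zsign i • M.grInv u.1, zsign j • N.grInv u.2) ∈ X := by
    have hle : X ≤ X.comap ((zsign i • M.grInv).prodMap (zsign j • N.grInv)) := by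
      rw [hX, Submodule.span_le]
      rintro _ ⟨y, rfl⟩
      have : ((zsign i • M.grInv).prodMap (zsign j • N.grInv)) (M.rho.prod N.rho y (v, w)) =
          zsign y.deg • M.rho.prod N.rho y (v, w) := by
        rw [prod_apply, LinearMap.prodMap_apply, LinearMap.smul_apply, LinearMap.smul_apply,
          M.grInv_of_mem (M.map_gr y i v hv.mem_gr), N.grInv_of_mem (N.map_gr y j w hw.mem_gr),
          smul_smul, smul_smul, zsign_add, zsign_add, ← mul_assoc, ← mul_assoc, zsign_mul_self,
          zsign_mul_self, one_mul, Prod.smul_mk]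
      change _ ∈ X
      rw [this]
      exact Submodule.smul_mem _ _ (Submodule.subset_span ⟨y, rfl⟩)
    exact fun u hu => hle hu
  -- The part of `X` over `0` is a graded submodule of the irreducible `N`; if it were everything,
  -- it would contain `w`.
  have hD : X.comap (LinearMap.inr ℂ V W) = ⊥ := by
    refine (hN.eq_bot_or_eq_top _ (fun x u hu => ?_) (fun u hu => ?_)).resolve_right fun h => ?_
    · have := hXrho x _ hu
      rwa [LinearMap.inr_apply, prod_apply, map_zero] at this
    · have h1 := X.smul_mem (zsign j) (hXgr _ hu)
      rwa [LinearMap.inr_apply, map_zero, smul_zero, Prod.smul_mk, smul_zero, smul_smul,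
        zsign_mul_self, one_smul] at h1
    · refine hw0 (zero_eq_of_zero_mem_span hbM hbN he hv hv0 hw ?_)
      have : w ∈ X.comap (LinearMap.inr ℂ V W) := by rw [h]; trivial
      exact this
  have hinj : Function.Injective (LinearMap.fst ℂ V W ∘ₗ X.subtype) := by
    rw [← LinearMap.ker_eq_bot, Submodule.eq_bot_iff]
    rintro ⟨⟨a, c⟩, hac⟩ h0
    obtain rfl : a = 0 := h0
    have hc : c ∈ X.comap (LinearMap.inr ℂ V W) := hac
    rw [hD, Submodule.mem_bot] at hc
    exact Subtype.ext (Prod.ext rfl hc)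
  -- The projection is onto because `v` generates `M`.
  have hsurj : Function.Surjective (LinearMap.fst ℂ V W ∘ₗ X.subtype) := by
    rw [← LinearMap.range_eq_top, eq_top_iff, ← hM.span_eq_top hv.mem_gr hv0, Submodule.span_le]
    rintro _ ⟨y, rfl⟩
    exact ⟨⟨_, hXrho y _ hvw⟩, rfl⟩
  let E := LinearEquiv.ofBijective _ ⟨hinj, hsurj⟩
  have hE : ∀ u (hu : u ∈ X), E.symm u.1 = ⟨u, hu⟩ := fun u hu => by
    rw [LinearEquiv.symm_apply_eq]
    rfl
  refine ⟨LinearMap.snd ℂ V W ∘ₗ X.subtype ∘ₗ E.symm.toLinearMap, fun x u => ?_, ?_⟩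
  · obtain ⟨⟨p, hp⟩, rfl⟩ := hsurj u
    change (E.symm (M.rho.prod N.rho x p).1 : V × W).2 = N.rho x (E.symm p.1 : V × W).2
    rw [hE _ (hXrho x p hp), hE p hp]
    rfl
  · change (E.symm (v, w).1 : V × W).2 = w
    rw [hE _ hvw]

/-- The space of intertwiners between irreducible supermodules with the same highest weight is a
line or a plane according to the parity of the number of blocks. -/
theorem finrank_intertwiningMap (hM : M.IsIrreducible) (hN : N.IsIrreducible)
    (hbM : IsHighest M.rho b) (hbN : IsHighest N.rho b) (he : IsBlockEnumeration b e n)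
    (hM0 : youngInvariants M.rho b ≠ ⊥) (hN0 : youngInvariants N.rho b ≠ ⊥) :
    Module.finrank ℂ (Representation.IntertwiningMap M.rho N.rho) = if Even n then 1 else 2 := by
  obtain ⟨i, v, hv0, hv⟩ := M.exists_isExtremal he hM0
  obtain ⟨j, w, hw0, hw⟩ := N.exists_isExtremal he hN0
  have hfam := he.isCliffordFamily N.rho_eps
  -- Evaluation at `v` is injective since `v` generates `M`; its range is shown to be spanned by the
  -- extremal vectors of `N`.
  let ev : Representation.IntertwiningMap M.rho N.rho →ₗ[ℂ] W :=
    { toFun := fun f => f v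
      map_add' := fun _ _ => rfl
      map_smul' := fun _ _ => rfl }
  have hinj : Function.Injective ev := by
    rw [← LinearMap.ker_eq_bot, Submodule.eq_bot_iff]
    intro f hf
    have hf : f v = 0 := hf
    apply Representation.IntertwiningMap.ext
    refine LinearMap.ker_eq_top.mp ?_
    rw [eq_top_iff, ← hM.span_eq_top hv.mem_gr hv0, Submodule.span_le]
    rintro _ ⟨x, rfl⟩
    change f (M.rho x v) = 0
    rw [f.isIntertwining, hf, map_zero]
  have hex : ∀ j w, N.IsExtremal b e n j w → w ∈ LinearMap.range ev := by
    intro j w hw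
    obtain ⟨f, hf, hfv⟩ := exists_intertwiner hM hN hbM hbN he hv hv0 hw
    exact ⟨f.intertwiningMap_of_isIntertwiningMap M.rho N.rho hf, hfv⟩
  -- The image of `v` is again invariant and fixed by the pair involutions, and it lies in the
  -- module generated by `w`, so the Clifford bound on fixed vectors applies to it.
  have hmem : ∀ u ∈ LinearMap.range ev, u ∈ stableSpan (normXi N.rho b e) (Set.Ico 0 n) w ∧
      ∀ r, 2 * r + 1 < n → cliffordPair (normXi N.rho b e) r u = u := by
    rintro _ ⟨f, rfl⟩
    change f v ∈ _ ∧ _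
    have hnorm : ∀ k x, normXi N.rho b e k (f x) = f (normXi M.rho b e k x) := by
      intro k x
      simp only [normXi, LinearMap.smul_apply, blockXi_apply, map_smul, map_sum,
        f.isIntertwining]
    refine ⟨mem_stableSpan_normXi N.rho_eps hbN he hw.mem_youngInvariants (fun g hg => ?_) ?_,
      fun r hr => ?_⟩
    · rw [← f.isIntertwining, hv.mem_youngInvariants g hg]
    · rw [hN.span_eq_top hw.mem_gr hw0]
      trivial
    · change cliffordPair (normXi N.rho b e) r (f v) = f v
      rw [cliffordPair_apply, hnorm, hnorm, ← map_smul, ← cliffordPair_apply, hv.fixed r hr]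
  rw [← LinearMap.finrank_range_of_inj hinj]
  split_ifs with hn
  · have hrange : LinearMap.range ev = Submodule.span ℂ {w} := by
      refine le_antisymm (fun u hu => ?_) ?_
      · obtain ⟨a, rfl⟩ := hfam.exists_eq_smul_of_even hn hw.fixed (hmem u hu).2 (hmem u hu).1
        exact Submodule.smul_mem _ _ (Submodule.mem_span_singleton_self w)
      · rw [Submodule.span_le, Set.singleton_subset_iff]
        exact hex j w hw
    rw [hrange, finrank_span_singleton hw0]
  · have hn : Odd n := Nat.not_even_iff_odd.mp hn
    have hlast := hw.normXi_last he hn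
    have hrange : LinearMap.range ev = Submodule.span ℂ {w, normXi N.rho b e (n - 1) w} := by
      refine le_antisymm (fun u hu => ?_) ?_
      · obtain ⟨a, a', rfl⟩ :=
          hfam.exists_eq_smul_add_of_odd hn hw.fixed (hmem u hu).2 (hmem u hu).1
        exact Submodule.mem_span_pair.mpr ⟨a, a', rfl⟩
      · rw [Submodule.span_le, Set.insert_subset_iff, Set.singleton_subset_iff]
        exact ⟨hex j w hw, hex _ _ hlast⟩
    have hn' : n - 1 < n := by
      obtain ⟨m, rfl⟩ := hn
      omega
    -- The two vectors are nonzero of opposite degrees.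
    have hlin : LinearIndependent ℂ ![w, normXi N.rho b e (n - 1) w] := by
      rw [LinearIndependent.pair_iff]
      intro a a' h
      have h1 : a • w = 0 := by
        refine N.eq_zero_of_mem_of_mem (Submodule.smul_mem _ _ hw.mem_gr) ?_
        rw [eq_neg_of_add_eq_zero_left h]
        exact Submodule.neg_mem _ (Submodule.smul_mem _ _ hlast.mem_gr)
      rw [h1, zero_add] at h
      refine ⟨(smul_eq_zero.mp h1).resolve_right hw0,
        (smul_eq_zero.mp h).resolve_right fun h3 => hw0 ?_⟩
      rw [← hfam.sq (n - 1) hn' w, h3, map_zero]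
    have := finrank_span_eq_card hlin
    rw [Matrix.range_cons, Matrix.range_cons, Matrix.range_empty, Set.union_empty,
      Set.singleton_union] at this
    rw [hrange, this, Fintype.card_fin]

theorem finrank_intertwiningMap_of_index {lam mu : d.Partition}
    (hM : M.IsIrreducibleOfIndex lam) (hN : N.IsIrreducibleOfIndex mu) :
    Module.finrank ℂ (Representation.IntertwiningMap M.rho N.rho) =
      if lam = mu then if Even lam.parts.card then 1 else 2 else 0 := by
  split_ifs with h hev
  all_goals try subst h
  pick_goal 3
  · have : Subsingleton (Representation.IntertwiningMap M.rho N.rho) := by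
      refine subsingleton_of_forall_eq 0 fun f => ?_
      by_contra hf
      exact h (hM.index_eq hN f.isIntertwining fun h0 => hf (Representation.IntertwiningMap.ext h0))
    exact Module.finrank_zero_of_subsingleton
  all_goals
    obtain ⟨b, hb, v, hv0, hv⟩ := hM.2.1
    obtain ⟨b', hb', w, hw0, hw⟩ := hN.2.1
    -- `M` and `N` may realize the weight on different decompositions; the invariants of `N` are
    -- moved to the decomposition `b` of `M`.
    obtain ⟨g, τ, hg⟩ := exists_perm_of_blockSizes_eq (hb.trans hb'.symm)
    obtain ⟨e, he⟩ := exists_isBlockEnumeration b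
    have hcard : lam.parts.card = (Finset.univ.image b).card := by
      rw [← hb, blockSizes, Multiset.card_map]
      rfl
    have := finrank_intertwiningMap hM.1 hN.1
      (fun l m h1 h2 => hM.youngInvariants_update_eq_bot hb h1 h2)
      (fun l m h1 h2 => hN.youngInvariants_update_eq_bot hb h1 h2) he
      ((Submodule.ne_bot_iff _).mpr ⟨v, hv, hv0⟩)
      (youngInvariants_ne_bot_of_conj hg ((Submodule.ne_bot_iff _).mpr ⟨w, hw, hw0⟩))
    rw [← hcard] at this
    simpa [hev] using this

end SpinSupermodule

/-! ### Conjugacy of elements of the Sergeev group up to `ε` -/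

namespace CliffordGroup

variable {d : ℕ}

/-- The product of the `ξ_i` over a set of letters, in increasing order. -/
def xiProd (Z : Finset (Fin d)) : CliffordGroup d := ⟨0, fun i => if i ∈ Z then 1 else 0⟩

theorem xiProd_vec_of_mem {Z : Finset (Fin d)} {i : Fin d} (h : i ∈ Z) : (xiProd Z).vec i = 1 :=
  if_pos h

theorem xiProd_vec_of_notMem {Z : Finset (Fin d)} {i : Fin d} (h : i ∉ Z) :
    (xiProd Z).vec i = 0 := if_neg h

/-- Each transposition of two letters of `Z` costs one `ε`, so the total is governed by the sign of
`τ`. -/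
theorem permAction_ofSubtype_xiProd (Z : Finset (Fin d)) (τ : Equiv.Perm {i // i ∈ Z}) :
    permAction d (Equiv.Perm.ofSubtype τ) (xiProd Z) =
      (if Equiv.Perm.sign τ = 1 then 1 else eps) * xiProd Z := by
  induction τ using Equiv.Perm.swap_induction_on with
  | one => simp
  | swap_mul τ p q hpq ih =>
    have h1 : permAction d (Equiv.swap (p : Fin d) q) (xiProd Z) = eps * xiProd Z :=
      permAction_swap_of_eq_one (fun h => hpq (Subtype.ext h)) (xiProd_vec_of_mem p.2)
        (xiProd_vec_of_mem q.2)
    rw [map_mul, map_mul, MulAut.mul_apply, ih, map_mul, Equiv.Perm.ofSubtype_swap_eq, h1,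
      Equiv.Perm.sign_mul, Equiv.Perm.sign_swap hpq]
    rcases Int.units_eq_one_or (Equiv.Perm.sign τ) with h | h
    · rw [h, if_pos rfl, if_neg (by decide), map_one, one_mul]
    · rw [h, if_neg (by decide), if_pos (by decide), permAction_eps, ← mul_assoc, eps_mul_eps]

/-- An even cycle reverses the sign of the product of its letters. -/
theorem permAction_xiProd_support {f : Equiv.Perm (Fin d)} (hf : f.IsCycle)
    (heven : Even f.support.card) : permAction d f (xiProd f.support) = eps * xiProd f.support := by
  have hp : ∀ i, f i ∈ f.support ↔ i ∈ f.support := fun i => Equiv.Perm.apply_mem_support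
  have h1 : Equiv.Perm.ofSubtype (f.subtypePerm hp) = f :=
    Equiv.Perm.ofSubtype_subtypePerm hp fun i hi => Equiv.Perm.mem_support.mpr hi
  have h2 := permAction_ofSubtype_xiProd f.support (f.subtypePerm hp)
  rw [← Equiv.Perm.sign_ofSubtype, h1, hf.sign, heven.neg_one_pow, if_neg (by decide)] at h2
  exact h2

end CliffordGroup

namespace SergeevGroup

variable {d : ℕ}

open CliffordGroup (permAction xiProd epsPow)

theorem eps_mul_eps : (eps : SergeevGroup d) * eps = 1 := by
  rw [← cl_eps, ← cl_mul, CliffordGroup.eps_mul_eps, cl_one]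

theorem cl_epsPow_mul (s : ZMod 2) (x : SergeevGroup d) : cl (epsPow s) * x = x * cl (epsPow s) := by
  rw [eq_cl_mul_pure x, mul_assoc, pure_mul_cl, CliffordGroup.permAction_epsPow, ← mul_assoc,
    ← mul_assoc, ← cl_mul, ← cl_mul, CliffordGroup.mul_epsPow]

theorem eps_mul (x : SergeevGroup d) : eps * x = x * eps := cl_epsPow_mul 1 x

theorem mul_left_vec (x y : SergeevGroup d) (i : Fin d) :
    (x * y).left.vec i = x.left.vec i + y.left.vec (x.right⁻¹ i) := rfl

theorem deg_mul (x y : SergeevGroup d) : (x * y).deg = x.deg + y.deg := by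
  simp only [deg, mul_left_vec, Finset.sum_add_distrib]
  rw [Equiv.sum_comp x.right⁻¹]

theorem deg_eq_of_isConj {x y : SergeevGroup d} (h : IsConj x y) : x.deg = y.deg := by
  obtain ⟨c, rfl⟩ := isConj_iff.mp h
  have : c.deg + (c⁻¹).deg = 0 := by
    rw [← deg_mul, mul_inv_cancel]
    exact Finset.sum_eq_zero fun _ _ => rfl
  rw [deg_mul, deg_mul, add_right_comm, this, zero_add]

/-- Conjugation by `y` does it. Such conjugacies force spin characters to vanish at `x`. -/
theorem isConj_eps_mul {x y : SergeevGroup d} (h : y * x = eps * (x * y)) : IsConj x (eps * x) :=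
  isConj_iff.mpr ⟨y, by rw [h, mul_assoc, mul_assoc, mul_inv_cancel, mul_one]⟩

/-- An even element that splits into two odd elements on complementary sets of letters is
conjugate to its product with `ε`. -/
theorem isConj_eps_mul_of_odd_invariant {x : SergeevGroup d} (hx : x.deg = 0) {Z : Finset (Fin d)}
    (hZ : ∀ i, x.right i ∈ Z ↔ i ∈ Z) (hodd : ∑ i ∈ Z, x.left.vec i = 1) :
    IsConj x (eps * x) := by
  set g := x.right with hg
  -- Up to a power of `ε`, `x` is the product of `y = c₁ g₁`, which lives on `Z`, and `z = c₂ g₁⁻¹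
  -- g`, which lives on the complement. Both are odd, so `y z = ε z y`, and conjugating `x` by `y`
  -- produces `ε x`.
  set g₁ : Equiv.Perm (Fin d) := Equiv.Perm.ofSubtype (g.subtypePerm hZ) with hg₁
  have hin : ∀ i ∈ Z, g₁ i = g i := fun i hi => by
    rw [hg₁, Equiv.Perm.ofSubtype_apply_of_mem _ hi, Equiv.Perm.subtypePerm_apply]
  have hout : ∀ i, i ∉ Z → g₁ i = i := fun i hi =>
    Equiv.Perm.ofSubtype_apply_of_not_mem _ hi
  set c₁ : CliffordGroup d := ⟨0, fun i => if i ∈ Z then x.left.vec i else 0⟩ with hc₁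
  set c₂ : CliffordGroup d := ⟨0, fun i => if i ∈ Z then 0 else x.left.vec i⟩ with hc₂
  have hp₁ : c₁.parity = 1 := by
    rw [← hodd, CliffordGroup.parity, Finset.sum_ite_mem, Finset.univ_inter]
  have hp₂ : c₂.parity = 1 := by
    have h1 : c₁.parity + c₂.parity = 0 := by
      rw [← hx, CliffordGroup.parity, CliffordGroup.parity, ← Finset.sum_add_distrib]
      refine Finset.sum_congr rfl fun i _ => ?_
      simp only [hc₁, hc₂]
      split_ifs <;> simp
    rw [hp₁] at h1
    rw [eq_neg_of_add_eq_zero_right h1]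
    decide
  -- Two odd Clifford elements with no common letter anticommute up to `ε`.
  have hcc : c₁ * c₂ = CliffordGroup.eps * (c₂ * c₁) := by
    rw [CliffordGroup.mul_eq_epsPow_mul_mul, hp₁, hp₂, Finset.sum_eq_zero, mul_one, add_zero,
      CliffordGroup.epsPow_one]
    intro i _
    simp only [hc₁, hc₂]
    split_ifs <;> simp
  have hfix₁ : permAction d g₁ c₂ = c₂ := by
    refine CliffordGroup.permAction_of_fixes fun i hi => hout i fun hiZ => hi ?_
    simp [hc₂, hiZ]
  have hfix₂ : permAction d (g₁⁻¹ * g) c₁ = c₁ := by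
    refine CliffordGroup.permAction_of_fixes fun i hi => ?_
    have hiZ : i ∈ Z := by
      by_contra h
      exact hi (by simp [hc₁, h])
    rw [Equiv.Perm.mul_apply, ← hin i hiZ]
    exact g₁.symm_apply_apply i
  have hcomm : g₁⁻¹ * g * g₁ = g := by
    ext i
    congr 1
    rw [Equiv.Perm.mul_apply, Equiv.Perm.mul_apply, Equiv.Perm.inv_eq_iff_eq]
    by_cases hi : i ∈ Z
    · rw [hin i hi, hin (g i) ((hZ i).mpr hi)]
    · rw [hout i hi, hout (g i) (fun h => hi ((hZ i).mp h))]
  have h12 : cl c₁ * pure g₁ * (cl c₂ * pure (g₁⁻¹ * g)) = cl (c₁ * c₂) * pure g := by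
    rw [mul_assoc, ← mul_assoc (pure g₁), pure_mul_cl, hfix₁, mul_assoc, ← pure_mul,
      mul_inv_cancel_left, ← mul_assoc, cl_mul]
  have h21 : cl c₂ * pure (g₁⁻¹ * g) * (cl c₁ * pure g₁) = cl (c₂ * c₁) * pure g := by
    rw [mul_assoc, ← mul_assoc (pure (g₁⁻¹ * g)), pure_mul_cl, hfix₂, mul_assoc, ← pure_mul,
      hcomm, ← mul_assoc, cl_mul]
  have hvec : x.left.vec = (c₁ * c₂).vec := by
    funext i
    rw [CliffordGroup.mul_vec]
    simp only [hc₁, hc₂]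
    split_ifs <;> simp
  obtain ⟨s, hs⟩ : ∃ s, x.left = epsPow s * (c₁ * c₂) := ⟨_, CliffordGroup.eq_epsPow_mul hvec⟩
  have hx' : x = cl (epsPow s) * (cl c₁ * pure g₁ * (cl c₂ * pure (g₁⁻¹ * g))) := by
    rw [h12, ← mul_assoc, ← cl_mul, ← hs, hg]
    exact eq_cl_mul_pure x
  have hanti : cl c₁ * pure g₁ * (cl c₂ * pure (g₁⁻¹ * g)) =
      eps * (cl c₂ * pure (g₁⁻¹ * g) * (cl c₁ * pure g₁)) := by
    rw [h12, h21, hcc, cl_mul, cl_eps, mul_assoc]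
  refine isConj_eps_mul (y := cl c₁ * pure g₁) ?_
  conv_rhs => rw [hx']
  conv_lhs => rw [hx']
  generalize cl c₁ * pure g₁ = y at hanti ⊢
  generalize cl c₂ * pure (g₁⁻¹ * g) = z at hanti ⊢
  rw [mul_assoc (cl (epsPow s)), mul_assoc y, ← mul_assoc eps, SergeevGroup.eps_mul, mul_assoc,
    ← mul_assoc eps, ← mul_assoc y (cl _), ← cl_epsPow_mul, mul_assoc]
  congr 1
  rw [mul_assoc eps, SergeevGroup.eps_mul, mul_assoc, ← SergeevGroup.eps_mul, ← hanti]

/-- An even element with an even cycle that carries an even number of letters is conjugate to its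
product with `ε`. -/
theorem isConj_eps_mul_of_even_cycle {x : SergeevGroup d} (hx : x.deg = 0)
    {f : Equiv.Perm (Fin d)} (hf : f ∈ x.right.cycleFactorsFinset) (heven : Even f.support.card)
    (hsum : ∑ i ∈ f.support, x.left.vec i = 0) : IsConj x (eps * x) := by
  have hcyc := (Equiv.Perm.mem_cycleFactorsFinset_iff.mp hf).1
  have hfg := (Equiv.Perm.mem_cycleFactorsFinset_iff.mp hf).2
  -- The product of the letters of the cycle is the conjugating element: the permutation part of `x`
  -- turns it into `ε` times itself, as a cycle of even length is an odd permutation.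
  have hact : permAction d x.right (xiProd f.support) = CliffordGroup.eps * xiProd f.support := by
    have h1 : x.right = f * (f⁻¹ * x.right) := by group
    rw [h1, map_mul, MulAut.mul_apply, CliffordGroup.permAction_of_fixes (g := f⁻¹ * x.right),
      CliffordGroup.permAction_xiProd_support hcyc heven]
    intro i hi
    have hi' : i ∈ f.support := by
      by_contra h
      exact hi (CliffordGroup.xiProd_vec_of_notMem h)
    rw [Equiv.Perm.mul_apply, ← hfg i hi']
    exact f.symm_apply_apply i
  -- The Clifford part gives no further `ε`: it is even and shares an even number of letters with
  -- the cycle.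
  have hcomm : x.left * xiProd f.support = xiProd f.support * x.left := by
    have hpar : x.left.parity = 0 := hx
    rw [CliffordGroup.mul_eq_epsPow_mul_mul, hpar, zero_mul, zero_add]
    have : ∑ i, x.left.vec i * (xiProd f.support).vec i = 0 := by
      rw [← hsum]
      simp only [xiProd, mul_ite, mul_one, mul_zero]
      rw [Finset.sum_ite_mem, Finset.univ_inter]
    rw [this, CliffordGroup.epsPow_zero, one_mul]
  refine isConj_eps_mul (y := cl (xiProd f.support)) ?_
  conv_rhs => rw [eq_cl_mul_pure x]
  conv_lhs => rw [eq_cl_mul_pure x]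
  rw [mul_assoc (cl x.left), pure_mul_cl, hact, cl_mul, cl_eps, ← mul_assoc (cl x.left),
    ← mul_assoc (cl x.left), ← SergeevGroup.eps_mul, ← mul_assoc eps, ← mul_assoc eps,
    ← mul_assoc eps, eps_mul_eps, one_mul, ← cl_mul, hcomm, cl_mul, mul_assoc]

/-- All cycles have odd length. -/
def IsOddPerm (g : Equiv.Perm (Fin d)) : Prop := ∀ k ∈ g.partition.parts, Odd k

theorem isOddPerm_iff {g : Equiv.Perm (Fin d)} : IsOddPerm g ↔ ∀ k ∈ g.cycleType, Odd k := by
  rw [IsOddPerm, Equiv.Perm.parts_partition]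
  refine ⟨fun h k hk => h k (Multiset.mem_add.mpr (Or.inl hk)), fun h k hk => ?_⟩
  rcases Multiset.mem_add.mp hk with hk | hk
  · exact h k hk
  · rw [Multiset.eq_of_mem_replicate hk]
    exact odd_one

/-- The order is the least common multiple of the cycle lengths, which divides their product. -/
theorem IsOddPerm.odd_orderOf {g : Equiv.Perm (Fin d)} (hg : IsOddPerm g) : Odd (orderOf g) := by
  rw [isOddPerm_iff] at hg
  rw [← Equiv.Perm.lcm_cycleType]
  generalize g.cycleType = m at hg
  induction m using Multiset.induction_on with
  | empty => simp
  | cons a m ih =>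
    rw [Multiset.lcm_cons]
    have h1 := hg a (Multiset.mem_cons_self a m)
    have h2 := ih fun k hk => hg k (Multiset.mem_cons_of_mem hk)
    exact Odd.of_dvd_nat (h1.mul h2) (Nat.lcm_dvd_mul a m.lcm)

/-- If all orbit sums of `a` vanish and `g` has odd cycles only, then the sum of `a` along the
powers of `g` vanishes. -/
theorem sum_pow_eq_zero {g : Equiv.Perm (Fin d)} (hg : IsOddPerm g) {a : Fin d → ZMod 2}
    (ha : ∀ Z : Finset (Fin d), (∀ i, g i ∈ Z ↔ i ∈ Z) → ∑ i ∈ Z, a i = 0) (i : Fin d) :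
    ∑ j ∈ Finset.range (orderOf g), a ((g ^ j) i) = 0 := by
  -- `Z` is the orbit of `i`: the support of its cycle, or `{i}` if `i` is fixed.
  obtain ⟨Z, hodd, hZ, hsame⟩ : ∃ Z : Finset (Fin d), Odd Z.card ∧ (∀ k, g k ∈ Z ↔ k ∈ Z) ∧
      ∀ k ∈ Z, g.SameCycle i k := by
    by_cases hi : i ∈ g.support
    · refine ⟨(g.cycleOf i).support, ?_, fun k => ?_, fun k hk => ?_⟩
      · refine isOddPerm_iff.mp hg _ ?_
        rw [Equiv.Perm.cycleType_def]
        exact Multiset.mem_map_of_mem _ (Equiv.Perm.cycleOf_mem_cycleFactorsFinset_iff.mpr hi)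
      · rw [Equiv.Perm.mem_support_cycleOf_iff, Equiv.Perm.mem_support_cycleOf_iff,
          Equiv.Perm.sameCycle_apply_right]
      · exact (Equiv.Perm.mem_support_cycleOf_iff.mp hk).1
    · rw [Equiv.Perm.notMem_support] at hi
      refine ⟨{i}, by simp, fun k => ?_, fun k hk => ?_⟩
      · rw [Finset.mem_singleton, Finset.mem_singleton]
        exact ⟨fun h => g.injective (h.trans hi.symm), fun h => by rw [h, hi]⟩
      · rw [Finset.mem_singleton.mp hk]
  set N : Fin d → ZMod 2 := fun k => ∑ j ∈ Finset.range (orderOf g), a ((g ^ j) k) with hN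
  have hNg : ∀ k, N (g k) = N k := by
    intro k
    have h1 := Finset.sum_range_succ (fun j => a ((g ^ j) k)) (orderOf g)
    rw [Finset.sum_range_succ', pow_orderOf_eq_one, pow_zero, add_left_inj] at h1
    simp only [hN]
    rw [← h1]
    refine Finset.sum_congr rfl fun j _ => ?_
    rw [pow_succ, Equiv.Perm.mul_apply]
  have hNconst : ∀ k ∈ Z, N k = N i := by
    intro k hk
    obtain ⟨m, rfl⟩ := (hsame k hk).exists_nat_pow_eq
    induction m with
    | zero => rfl
    | succ m ih =>
      have hmem : (g ^ m) i ∈ Z := by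
        rwa [pow_succ', Equiv.Perm.mul_apply, hZ] at hk
      rw [pow_succ', Equiv.Perm.mul_apply, hNg, ih hmem]
  have hpow : ∀ j k, (g ^ j) k ∈ Z ↔ k ∈ Z := by
    intro j
    induction j with
    | zero => exact fun k => Iff.rfl
    | succ j ih =>
      intro k
      rw [pow_succ', Equiv.Perm.mul_apply, hZ, ih]
  -- `N` is constant on the orbit, whose size is 1 modulo 2. Exchanging the sums expresses the same
  -- total through the orbit sums of `a`, which vanish.
  have h1 : ∑ k ∈ Z, N k = N i := by
    rw [Finset.sum_congr rfl hNconst, Finset.sum_const, nsmul_eq_mul,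
      (ZMod.natCast_eq_one_iff_odd).mpr hodd, one_mul]
  have h2 : ∑ k ∈ Z, N k = 0 := by
    simp only [hN]
    rw [Finset.sum_comm]
    refine Finset.sum_eq_zero fun j _ => ?_
    rw [← ha Z hZ]
    exact Finset.sum_equiv (g ^ j) (fun k => (hpow j k).symm) fun k _ => rfl
  exact h1.symm.trans h2

/-- An element over a permutation with odd cycles only that carries an even number of letters on
each cycle is conjugate to a pure permutation up to `ε`. -/
theorem exists_isConj_pure {x : SergeevGroup d} (hg : IsOddPerm x.right)
    (ha : ∀ Z : Finset (Fin d), (∀ i, x.right i ∈ Z ↔ i ∈ Z) → ∑ i ∈ Z, x.left.vec i = 0) :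
    IsConj (pure x.right) x ∨ IsConj (pure x.right) (eps * x) := by
  set g := x.right with hgx
  set a := x.left.vec with hax
  have hg' : IsOddPerm g⁻¹ := by
    rw [isOddPerm_iff, Equiv.Perm.cycleType_inv]
    exact isOddPerm_iff.mp hg
  have ha' : ∀ Z : Finset (Fin d), (∀ i, g⁻¹ i ∈ Z ↔ i ∈ Z) → ∑ i ∈ Z, a i = 0 := by
    intro Z hZ
    refine ha Z fun i => ?_
    rw [← hZ (g i)]
    exact iff_of_eq (congrArg (· ∈ Z) (g.symm_apply_apply i))
  obtain ⟨m, hm⟩ := hg'.odd_orderOf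
  set h := g⁻¹ with hh
  -- Conjugating `pure g` by `cl u` adds the letters `u_i + u_{h i}` with `h = g⁻¹`, so this must
  -- equal `a_i`. As `h` has odd order `2 * m + 1`, summing `a` over the odd powers below `2 * m +
  -- 1` solves the equation: `u_i + u_{h i}` runs over all nontrivial powers, and the sum over all
  -- powers is zero.
  let u : CliffordGroup d := ⟨0, fun i => ∑ k ∈ Finset.range m, a ((h ^ (2 * k + 1)) i)⟩
  have hu : ∀ i, u.vec i + u.vec (h i) = a i := by
    intro i
    have h1 := sum_pow_eq_zero hg' ha' i
    rw [hm, Finset.sum_range_succ', pow_zero] at h1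
    have h2 : u.vec i + u.vec (h i) = ∑ j ∈ Finset.range (2 * m), a ((h ^ (j + 1)) i) := by
      simp only [u]
      rw [← Finset.sum_add_distrib]
      clear h1 hm
      induction m with
      | zero => simp
      | succ m ih =>
        rw [Finset.sum_range_succ, ih, Nat.mul_succ, Finset.sum_range_succ,
          Finset.sum_range_succ, pow_succ h (2 * m + 1), Equiv.Perm.mul_apply, add_assoc]
    rw [h2]
    refine (eq_neg_of_add_eq_zero_left h1).trans ?_
    rw [CharTwo.neg_eq]
    rfl
  have hconj : cl u * pure g * (cl u)⁻¹ = cl (u * (permAction d g u)⁻¹) * pure g := by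
    rw [cl_mul, mul_assoc, mul_assoc]
    congr 1
    have : (cl u)⁻¹ = cl u⁻¹ := (map_inv SemidirectProduct.inl u).symm
    rw [this, pure_mul_cl, map_inv]
  have hvec : x.left.vec = (u * (permAction d g u)⁻¹).vec := by
    funext i
    rw [CliffordGroup.mul_vec, CliffordGroup.inv_def]
    change a i = u.vec i + u.vec (g⁻¹ i)
    rw [hu]
  -- Only the exponent of `ε` remains undetermined; its two values are the two alternatives.
  obtain ⟨s, hs⟩ : ∃ s, x.left = epsPow s * (u * (permAction d g u)⁻¹) :=
    ⟨_, CliffordGroup.eq_epsPow_mul hvec⟩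
  have hx : x = cl (epsPow s) * (cl u * pure g * (cl u)⁻¹) := by
    rw [hconj, ← mul_assoc, ← cl_mul, ← hs, hgx]
    exact eq_cl_mul_pure x
  obtain rfl | rfl := zmod_two_eq_zero_or_one s
  · rw [CliffordGroup.epsPow_zero, cl_one, one_mul] at hx
    exact Or.inl (isConj_iff.mpr ⟨cl u, hx.symm⟩)
  · rw [CliffordGroup.epsPow_one, cl_eps] at hx
    refine Or.inr (isConj_iff.mpr ⟨cl u, ?_⟩)
    rw [hx, ← mul_assoc eps, eps_mul_eps, one_mul]

/-- An element of even degree is conjugate to its product with `ε`, or, up to `ε`, to a pure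
permutation with odd cycles only. -/
theorem isConj_eps_mul_or_exists {x : SergeevGroup d} (hx : x.deg = 0) :
    IsConj x (eps * x) ∨ ∃ g, IsOddPerm g ∧ (IsConj (pure g) x ∨ IsConj (pure g) (eps * x)) := by
  by_cases h : ∃ Z : Finset (Fin d), (∀ i, x.right i ∈ Z ↔ i ∈ Z) ∧ ∑ i ∈ Z, x.left.vec i = 1
  · obtain ⟨Z, hZ, hodd⟩ := h
    exact Or.inl (isConj_eps_mul_of_odd_invariant hx hZ hodd)
  push Not at h
  have ha : ∀ Z : Finset (Fin d), (∀ i, x.right i ∈ Z ↔ i ∈ Z) → ∑ i ∈ Z, x.left.vec i = 0 :=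
    fun Z hZ => (zmod_two_eq_zero_or_one _).resolve_right (h Z hZ)
  by_cases hg : IsOddPerm x.right
  · exact Or.inr ⟨x.right, hg, exists_isConj_pure hg ha⟩
  · rw [isOddPerm_iff, Equiv.Perm.cycleType_def] at hg
    push Not at hg
    obtain ⟨k, hk, heven⟩ := hg
    obtain ⟨f, hf, rfl⟩ := Multiset.mem_map.mp hk
    have hf : f ∈ x.right.cycleFactorsFinset := hf
    refine Or.inl (isConj_eps_mul_of_even_cycle hx hf (Nat.not_odd_iff_even.mp heven)
      (ha _ fun i => ?_))
    rw [Equiv.Perm.mem_cycleFactorsFinset_support hf]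

end SergeevGroup

/-! ### Vanishing of spin characters, and central characters -/

namespace SergeevGroup

variable {d : ℕ} {V : Type*} [AddCommGroup V] [Module ℂ V]
  {ρ : Representation ℂ (SergeevGroup d) V}

theorem character_eq_of_isConj {x y : SergeevGroup d} (h : IsConj x y) :
    ρ.character x = ρ.character y := by
  obtain ⟨c, rfl⟩ := isConj_iff.mp h
  exact (ρ.char_conj x c).symm

theorem character_eps_mul (hε : ρ eps = -1) (x : SergeevGroup d) :
    ρ.character (eps * x) = -ρ.character x := by
  rw [Representation.character, map_mul, hε, neg_one_mul, map_neg]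
  rfl

/-- The character takes equal values at conjugate elements, while `ε` changes its sign. -/
theorem character_eq_zero (hε : ρ eps = -1) {x : SergeevGroup d} (h : IsConj x (eps * x)) :
    ρ.character x = 0 := by
  have h1 := character_eq_of_isConj (ρ := ρ) h
  rw [character_eps_mul hε] at h1
  exact self_eq_neg.mp h1

theorem isConj_pure {g h : Equiv.Perm (Fin d)} (hgh : IsConj g h) :
    IsConj (pure g) (pure h) := by
  obtain ⟨c, rfl⟩ := isConj_iff.mp hgh
  exact isConj_iff.mpr ⟨pure c, by
    rw [pure_mul, pure_mul, pure, pure, pure, map_inv]⟩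

theorem isConj_right {x y : SergeevGroup d} (h : IsConj x y) : IsConj x.right y.right := by
  obtain ⟨c, rfl⟩ := isConj_iff.mp h
  exact isConj_iff.mpr ⟨c.right, rfl⟩

/-- A permutation is conjugate to its inverse, both having the same cycle type. This turns `χ(x⁻¹)`
into `χ(x)` on the classes that matter. -/
theorem character_pure_inv (g : Equiv.Perm (Fin d)) :
    ρ.character (pure g)⁻¹ = ρ.character (pure g) := by
  have h1 : (pure g)⁻¹ = pure g⁻¹ := (map_inv SemidirectProduct.inr g).symm
  rw [h1]
  exact character_eq_of_isConj (isConj_pure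
    (Equiv.Perm.isConj_iff_cycleType_eq.mpr (Equiv.Perm.cycleType_inv g)))

theorem isConj_inv {x y : SergeevGroup d} (h : IsConj x y) : IsConj x⁻¹ y⁻¹ := by
  obtain ⟨c, rfl⟩ := isConj_iff.mp h
  exact isConj_iff.mpr ⟨c, by group⟩

end SergeevGroup

namespace SpinSupermodule

open SergeevGroup

variable {d : ℕ} {V W : Type*} [AddCommGroup V] [Module ℂ V] [AddCommGroup W] [Module ℂ W]

/-- Conjugation by the grading involution negates an odd operator, so its trace is zero. -/
theorem character_eq_zero_of_deg [FiniteDimensional ℂ V] (M : SpinSupermodule d V) {x : SergeevGroup d} (hx : x.deg = 1) :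
    M.rho.character x = 0 := by
  have h1 : M.grInv ∘ₗ M.rho x ∘ₗ M.grInv = -M.rho x := by
    ext v
    simp only [LinearMap.comp_apply, LinearMap.neg_apply]
    rw [M.grInv_rho, M.grInv_grInv, hx, zsign, if_neg one_ne_zero, neg_one_smul]
  have h2 : M.grInv ∘ₗ M.grInv = LinearMap.id := by
    ext v
    exact M.grInv_grInv v
  have h3 := congrArg (LinearMap.trace ℂ V) h1
  rw [LinearMap.trace_comp_comm', LinearMap.comp_assoc, h2, LinearMap.comp_id, map_neg] at h3
  exact self_eq_neg.mp h3

open Classical in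
/-- Summing `χ_N(x) χ_M(x⁻¹)` over the group amounts to summing twice over the elements conjugate to
a pure permutation with odd cycles only. -/
theorem sum_character_eq [FiniteDimensional ℂ W] (M : SpinSupermodule d V) (N : SpinSupermodule d W) :
    ∑ x, N.rho.character x * M.rho.character x⁻¹ =
      2 * ∑ x with ∃ g, IsOddPerm g ∧ IsConj (SergeevGroup.pure g) x,
        N.rho.character x * M.rho.character x⁻¹ := by
  set F : SergeevGroup d → ℂ := fun x => N.rho.character x * M.rho.character x⁻¹ with hF
  set U : SergeevGroup d → Prop := fun x => ∃ g, IsOddPerm g ∧ IsConj (SergeevGroup.pure g) x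
    with hU
  have hFeps : ∀ x, F (eps * x) = F x := by
    intro x
    have h1 : (eps * x)⁻¹ = eps * x⁻¹ := by
      rw [mul_inv_rev, inv_eq_of_mul_eq_one_left eps_mul_eps, SergeevGroup.eps_mul]
    simp only [hF]
    rw [h1, character_eps_mul N.rho_eps, character_eps_mul M.rho_eps, neg_mul_neg]
  -- Where `F` can be nonzero, exactly one of `x` and `εx` is conjugate to a pure permutation with
  -- odd cycles.
  have hpt : ∀ x, F x = (if U x then F x else 0) + if U (eps * x) then F (eps * x) else 0 := by
    intro x
    by_cases hc : IsConj x (eps * x)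
    · have h0 : F x = 0 := by
        simp only [hF]
        rw [character_eq_zero N.rho_eps hc, zero_mul]
      rw [hFeps, h0]
      simp
    obtain hdeg | hdeg := zmod_two_eq_zero_or_one x.deg
    · rcases isConj_eps_mul_or_exists hdeg with h | ⟨g, hg, h | h⟩
      · exact absurd h hc
      · have h1 : U x := ⟨g, hg, h⟩
        -- If both were, the two permutations would be conjugate in `S(d)`, by projecting to it, and
        -- `x` would be conjugate to `εx`.
        have h2 : ¬U (eps * x) := by
          rintro ⟨g', hg', h'⟩
          have hr : IsConj g g' :=
            (isConj_right h).trans (isConj_right h').symm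
          exact hc (h.symm.trans ((isConj_pure hr).trans h'))
        rw [if_pos h1, if_neg h2, add_zero]
      · have h1 : U (eps * x) := ⟨g, hg, h⟩
        have h2 : ¬U x := by
          rintro ⟨g', hg', h'⟩
          have hr : IsConj g' g :=
            (isConj_right h').trans (isConj_right h).symm
          exact hc (h'.symm.trans ((isConj_pure hr).trans h))
        rw [if_neg h2, if_pos h1, zero_add, hFeps]
    · have h0 : F x = 0 := by
        simp only [hF]
        rw [N.character_eq_zero_of_deg hdeg, zero_mul]
      rw [hFeps, h0]
      simp
  have hshift : ∑ x, (if U (eps * x) then F (eps * x) else 0) = ∑ x, if U x then F x else 0 :=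
    Equiv.sum_comp (Equiv.mulLeft (eps : SergeevGroup d)) fun x => if U x then F x else 0
  rw [Finset.sum_congr rfl fun x _ => hpt x, Finset.sum_add_distrib, hshift, ← two_mul,
    Finset.sum_filter]

/-- The class sum acts by its central character. -/
theorem IsIrreducible.classSum_eq [FiniteDimensional ℂ V] {M : SpinSupermodule d V}
    (hM : M.IsIrreducible) (γ : d.Partition) :
    M.classSum γ = M.centralChar γ • LinearMap.id := by
  classical
  -- The class sum commutes with the group and is even, so Schur's lemma supplies a constant for
  -- `Classical.epsilon` to choose.
  refine Classical.epsilon_spec (p := fun c : ℂ => M.classSum γ = c • LinearMap.id)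
    (hM.exists_eq_smul_id _ (fun x v => ?_) fun v => ?_)
  · simp only [classSum, LinearMap.sum_apply, map_sum]
    refine Finset.sum_equiv (MulAut.conj x⁻¹).toEquiv (fun y => ?_) fun y _ => ?_
    · rw [Set.mem_toFinset, Set.mem_toFinset]
      have hxy : IsConj y ((MulAut.conj x⁻¹).toEquiv y) := isConj_iff.mpr ⟨x⁻¹, rfl⟩
      exact ⟨fun ⟨g, hg, h⟩ => ⟨g, hg, h.trans hxy⟩, fun ⟨g, hg, h⟩ => ⟨g, hg, h.trans hxy.symm⟩⟩
    · rw [rho_apply_apply, rho_apply_apply]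
      congr 2
      change y * x = x * (x⁻¹ * y * x⁻¹⁻¹)
      group
  · simp only [classSum, LinearMap.sum_apply, map_sum]
    refine Finset.sum_congr rfl fun y hy => ?_
    obtain ⟨g, -, h⟩ := Set.mem_toFinset.mp hy
    rw [M.grInv_rho, ← deg_eq_of_isConj h, deg_pure, zsign, if_pos rfl, one_smul]

theorem mem_conjClass {γ : d.Partition} {g : Equiv.Perm (Fin d)}
    (hg : g.partition.parts = γ.parts) {x : SergeevGroup d} :
    x ∈ conjClass γ ↔ IsConj (SergeevGroup.pure g) x := by
  refine ⟨fun ⟨h, hh, hx⟩ => (isConj_pure ?_).trans hx, fun hx => ⟨g, hg, hx⟩⟩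
  exact Equiv.Perm.partition_eq_of_isConj.mpr (Nat.Partition.ext (hg.trans hh.symm))

/-- Both sides are the trace of the class sum. -/
theorem IsIrreducible.centralChar_mul_finrank [FiniteDimensional ℂ V] {M : SpinSupermodule d V}
    (hM : M.IsIrreducible) {γ : d.Partition} {g : Equiv.Perm (Fin d)}
    (hg : g.partition.parts = γ.parts) :
    M.centralChar γ * Module.finrank ℂ V =
      (conjClass γ).ncard * M.rho.character (SergeevGroup.pure g) := by
  classical
  have h1 := congrArg (LinearMap.trace ℂ V) (hM.classSum_eq γ)
  rw [map_smul, LinearMap.trace_id, smul_eq_mul, classSum, map_sum] at h1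
  change ∑ x ∈ _, M.rho.character x = _ at h1
  rw [← h1, Set.ncard_eq_toFinset_card', Finset.sum_congr rfl fun x hx =>
    (character_eq_of_isConj (ρ := M.rho) ((mem_conjClass hg).mp (Set.mem_toFinset.mp hx))).symm,
    Finset.sum_const, nsmul_eq_mul]

end SpinSupermodule

/-! ### Centralizers and class sizes -/

open Equiv.Perm in
/-- The number of functions into a two-element set that are constant on the cycles of `g`. -/
theorem Equiv.Perm.card_invariant_functions {d : ℕ} (g : Equiv.Perm (Fin d)) :
    Nat.card {a : Fin d → ZMod 2 // ∀ i, a (g i) = a i} = 2 ^ g.partition.parts.card := by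
  classical
  have hT : Fintype.card (g.cycleFactorsFinset ⊕ Function.fixedPoints g) = g.partition.parts.card := by
    rw [Fintype.card_sum, Fintype.card_coe, card_fixedPoints, parts_partition, Multiset.card_add,
      Multiset.card_replicate, sum_cycleType, cycleType_def, Multiset.card_map]
    rfl
  -- `π` sends a letter to its cycle, fixed points counting as cycles. Invariant functions are
  -- exactly the pullbacks along `π`.
  let π : Fin d → g.cycleFactorsFinset ⊕ Function.fixedPoints g := fun i =>
    if h : i ∈ g.support then Sum.inl ⟨g.cycleOf i, cycleOf_mem_cycleFactorsFinset_iff.mpr h⟩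
    else Sum.inr ⟨i, notMem_support.mp h⟩
  have hπg : ∀ i, π (g i) = π i := by
    intro i
    by_cases h : i ∈ g.support
    · have h' : g i ∈ g.support := apply_mem_support.mpr h
      simp only [π, h, h', dif_pos]
      congr 2
      exact (sameCycle_iff_cycleOf_eq_of_mem_support h' h).mp
        (sameCycle_apply_left.mpr (SameCycle.refl g i))
    · rw [notMem_support.mp h]
  have hsurj : Function.Surjective π := by
    rintro (⟨f, hf⟩ | ⟨i, hi⟩)
    · obtain ⟨hcyc, hfg⟩ := mem_cycleFactorsFinset_iff.mp hf
      obtain ⟨i, hi⟩ := hcyc.nonempty_support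
      have hig : i ∈ g.support := mem_cycleFactorsFinset_support_le hf hi
      refine ⟨i, ?_⟩
      simp only [π, hig, dif_pos]
      congr 2
      exact (cycle_is_cycleOf hi hf).symm
    · have h : i ∉ g.support := notMem_support.mpr hi
      refine ⟨i, ?_⟩
      simp only [π, h]
      rfl
  have hfib : ∀ i j, π i = π j → g.SameCycle i j := by
    intro i j hij
    by_cases hi : i ∈ g.support <;> by_cases hj : j ∈ g.support
    · simp only [π, hi, hj, dif_pos, Sum.inl.injEq, Subtype.mk.injEq] at hij
      exact (sameCycle_iff_cycleOf_eq_of_mem_support hi hj).mpr hij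
    · simp only [π, hi, hj, dif_pos, dif_neg, not_false_iff, reduceCtorEq] at hij
    · simp only [π, hi, hj, dif_pos, dif_neg, not_false_iff, reduceCtorEq] at hij
    · simp only [π, hi, hj, dif_neg, not_false_iff, Sum.inr.injEq] at hij
      rw [show i = j from congrArg Subtype.val hij]
  have hconst : ∀ a : Fin d → ZMod 2, (∀ i, a (g i) = a i) → ∀ i j, g.SameCycle i j → a i = a j := by
    intro a ha i j hij
    obtain ⟨m, rfl⟩ := hij.exists_nat_pow_eq
    induction m with
    | zero => rfl
    | succ m ih => rw [pow_succ', mul_apply, ha]; exact ih ⟨m, rfl⟩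
  let Φ : (g.cycleFactorsFinset ⊕ Function.fixedPoints g → ZMod 2) →
      {a : Fin d → ZMod 2 // ∀ i, a (g i) = a i} := fun t =>
    ⟨fun i => t (π i), fun i => congrArg t (hπg i)⟩
  have hΦ : Function.Bijective Φ := by
    constructor
    · intro t t' h
      funext k
      obtain ⟨i, rfl⟩ := hsurj k
      exact congrFun (congrArg Subtype.val h) i
    · rintro ⟨a, ha⟩
      refine ⟨fun k => a (Function.surjInv hsurj k), Subtype.ext (funext fun i => ?_)⟩
      exact hconst a ha _ _ (hfib _ _ (Function.surjInv_eq hsurj (π i)))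
  rw [← Nat.card_congr (Equiv.ofBijective Φ hΦ), Nat.card_eq_fintype_card, Fintype.card_fun,
    ZMod.card, hT]

namespace SergeevGroup

variable {d : ℕ}

open CliffordGroup (permAction epsPow)

/-- A permutation of odd order fixes every element of the Clifford group whose letters it
permutes. -/
theorem permAction_eq_self {g : Equiv.Perm (Fin d)} (hg : Odd (orderOf g)) {c : CliffordGroup d}
    (hc : ∀ i, c.vec (g i) = c.vec i) : permAction d g c = c := by
  have hvec : (permAction d g c).vec = c.vec := by
    funext i
    rw [CliffordGroup.permAction_vec, ← hc]
    exact congrArg c.vec (g.apply_symm_apply i)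
  obtain ⟨s, hs⟩ : ∃ s, permAction d g c = epsPow s * c := ⟨_, CliffordGroup.eq_epsPow_mul hvec⟩
  obtain rfl | rfl := zmod_two_eq_zero_or_one s
  · rw [hs, CliffordGroup.epsPow_zero, one_mul]
  exfalso
  rw [CliffordGroup.epsPow_one] at hs
  -- If `g` sent `c` to `ε c`, even powers of `g` would fix `c` and odd powers would send it to `ε
  -- c`; but `g` to its odd order is the identity.
  have heven : ∀ m, permAction d (g ^ (2 * m)) c = c := by
    intro m
    induction m with
    | zero => simp
    | succ m ih =>
      rw [mul_add, mul_one, pow_add, map_mul, MulAut.mul_apply, pow_two, map_mul, MulAut.mul_apply,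
        hs, map_mul, CliffordGroup.permAction_eps, hs, ← mul_assoc, CliffordGroup.eps_mul_eps,
        one_mul, ih]
  obtain ⟨m, hm⟩ := hg
  have h1 : permAction d (g ^ (2 * m + 1)) c = c := by
    rw [← hm, pow_orderOf_eq_one, map_one, MulAut.one_apply]
  rw [pow_succ', map_mul, MulAut.mul_apply, heven, hs] at h1
  have h2 : (1 : ZMod 2) = 0 := congrArg CliffordGroup.sgn (mul_eq_right.mp h1)
  exact absurd h2 (by decide)

/-- The number of elements of the Clifford group fixed by a permutation with odd cycles only. -/
theorem card_fixed {g : Equiv.Perm (Fin d)} (hg : IsOddPerm g) :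
    Nat.card {c : CliffordGroup d // permAction d g c = c} = 2 ^ (g.partition.parts.card + 1) := by
  have e : {c : CliffordGroup d // permAction d g c = c} ≃
      ZMod 2 × {a : Fin d → ZMod 2 // ∀ i, a (g i) = a i} :=
    { toFun := fun c => (c.1.sgn, ⟨c.1.vec, fun i => by
        have h1 := congrArg (fun x => x.vec (g i)) c.2
        rw [← h1]
        change c.1.vec (g⁻¹ (g i)) = _
        exact congrArg _ (g.symm_apply_apply i)⟩)
      invFun := fun p => ⟨⟨p.1, p.2.1⟩, permAction_eq_self hg.odd_orderOf p.2.2⟩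
      left_inv := fun _ => rfl
      right_inv := fun _ => rfl }
  rw [Nat.card_congr e, Nat.card_prod, Equiv.Perm.card_invariant_functions,
    Nat.card_eq_fintype_card, ZMod.card, pow_succ']

/-- Comparing components of the two products separates the conditions on the Clifford part and on
the permutation, so the centralizer is counted as a product of two sets. -/
theorem mem_centralizer_pure {g : Equiv.Perm (Fin d)} {x : SergeevGroup d} :
    x ∈ Subgroup.centralizer {pure g} ↔
      permAction d g x.left = x.left ∧ x.right ∈ Subgroup.centralizer {g} := by
  rw [Subgroup.mem_centralizer_singleton_iff, Subgroup.mem_centralizer_singleton_iff,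
    SemidirectProduct.ext_iff]
  simp [pure, eq_comm]

theorem card_centralizer {g : Equiv.Perm (Fin d)} (hg : IsOddPerm g) :
    Nat.card (Subgroup.centralizer {pure g}) =
      2 ^ (g.partition.parts.card + 1) * Nat.card (Subgroup.centralizer {g}) := by
  have e : Subgroup.centralizer {pure g} ≃
      {c : CliffordGroup d // permAction d g c = c} × Subgroup.centralizer {g} :=
    { toFun := fun x => (⟨x.1.left, (mem_centralizer_pure.mp x.2).1⟩,
        ⟨x.1.right, (mem_centralizer_pure.mp x.2).2⟩)
      invFun := fun p => ⟨⟨p.1.1, p.2.1⟩, mem_centralizer_pure.mpr ⟨p.1.2, p.2.2⟩⟩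
      left_inv := fun _ => rfl
      right_inv := fun _ => rfl }
  rw [Nat.card_congr e, Nat.card_prod, card_fixed hg]

/-- `cycleType` omits fixed points, whereas `z_γ` counts them as parts of size 1. With `r` fixed
points, those parts contribute `1 ^ r * r!`. -/
theorem card_centralizer_perm {γ : d.Partition} {g : Equiv.Perm (Fin d)}
    (hg : g.partition.parts = γ.parts) : Nat.card (Subgroup.centralizer {g}) = γ.zNum := by
  rw [Equiv.Perm.nat_card_centralizer, Nat.Partition.zNum, Finset.prod_mul_distrib,
    ← Finset.prod_multiset_count, ← hg, Equiv.Perm.parts_partition, Equiv.Perm.sum_cycleType]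
  set m := g.cycleType with hm
  set r := Fintype.card (Fin d) - g.support.card with hr
  have h1 : m.count 1 = 0 :=
    Multiset.count_eq_zero.mpr fun h => absurd (Equiv.Perm.two_le_of_mem_cycleType h) (by decide)
  have hcount1 : (m + Multiset.replicate r 1).count 1 = r := by
    rw [Multiset.count_add, h1, Multiset.count_replicate_self, zero_add]
  have hcount : ∀ k, k ≠ 1 → (m + Multiset.replicate r 1).count k = m.count k := by
    intro k hk
    rw [Multiset.count_add, Multiset.count_replicate, if_neg hk.symm, add_zero]
  -- Inserting `1` into the index set is harmless even when there are no fixed points, since `0! =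
  -- 1`.
  have hsub : ∏ k ∈ (m + Multiset.replicate r 1).toFinset,
      ((m + Multiset.replicate r 1).count k).factorial =
      ∏ k ∈ insert 1 m.toFinset, ((m + Multiset.replicate r 1).count k).factorial := by
    refine Finset.prod_subset (fun k hk => ?_) fun k _ hk => ?_
    · rw [Finset.mem_insert, Multiset.mem_toFinset]
      rw [Multiset.mem_toFinset, Multiset.mem_add] at hk
      exact hk.symm.imp (fun h => Multiset.eq_of_mem_replicate h) id
    · rw [Multiset.mem_toFinset] at hk
      rw [Multiset.count_eq_zero.mpr hk, Nat.factorial_zero]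
  have h1m : 1 ∉ m.toFinset := by
    rw [Multiset.mem_toFinset, ← Multiset.count_eq_zero, h1]
  have hprod : ∏ k ∈ m.toFinset, ((m + Multiset.replicate r 1).count k).factorial =
      ∏ k ∈ m.toFinset, (m.count k).factorial :=
    Finset.prod_congr rfl fun k hk => by rw [hcount k fun h => h1m (h ▸ hk)]
  rw [hsub, Finset.prod_insert h1m, hcount1, Multiset.prod_add, Multiset.prod_replicate, one_pow,
    mul_one, hprod]
  ring

/-- The parts other than 1 are realized as a cycle type, and the parts equal to 1 become the fixed
points. -/
theorem exists_perm_partition (γ : d.Partition) :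
    ∃ g : Equiv.Perm (Fin d), g.partition.parts = γ.parts := by
  have hle : (γ.parts.filter (· ≠ 1)).sum + γ.parts.count 1 = d := by
    have h1 := congrArg Multiset.sum (Multiset.filter_add_not (· ≠ 1) γ.parts)
    rw [Multiset.sum_add, γ.parts_sum] at h1
    simp only [not_not, Multiset.filter_eq', Multiset.sum_replicate, smul_eq_mul, mul_one] at h1
    exact h1
  obtain ⟨g, hg⟩ := (Equiv.Perm.exists_with_cycleType_iff (Fin d)
    (m := γ.parts.filter (· ≠ 1))).mpr ⟨by rw [Fintype.card_fin]; omega, fun a ha => by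
      obtain ⟨h1, h2⟩ := Multiset.mem_filter.mp ha
      have := γ.parts_pos h1
      omega⟩
  refine ⟨g, ?_⟩
  rw [Equiv.Perm.parts_partition, ← Equiv.Perm.sum_cycleType, hg, Fintype.card_fin,
    show d - (γ.parts.filter (· ≠ 1)).sum = γ.parts.count 1 by omega, ← Multiset.filter_eq']
  conv_rhs => rw [← Multiset.filter_add_not (· ≠ 1) γ.parts]
  simp only [not_not]

/-- The class of an odd partition `γ` has `|C(d)| / ϑ_γ` elements. -/
theorem ncard_conjClass_mul_vartheta {γ : d.Partition} {g : Equiv.Perm (Fin d)}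
    (hg : g.partition.parts = γ.parts) (hodd : IsOddPerm g) :
    (conjClass γ).ncard * γ.vartheta = Fintype.card (SergeevGroup d) := by
  have h1 : γ.vartheta = Nat.card (Subgroup.centralizer {pure g}) := by
    rw [card_centralizer hodd, card_centralizer_perm hg, hg, Nat.Partition.vartheta]
  have h2 : conjClass γ = MulAction.orbit (ConjAct (SergeevGroup d)) (pure g) := by
    ext x
    rw [SpinSupermodule.mem_conjClass hg, ConjAct.mem_orbit_conjAct, isConj_comm]
  -- Orbit-stabilizer for the conjugation action.
  rw [h1, h2, Subgroup.nat_card_centralizer_nat_card_stabilizer, ← MulAction.index_stabilizer,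
    mul_comm, Subgroup.card_mul_index, ← Nat.card_eq_fintype_card]
  rfl

end SergeevGroup

/-! ### Orthogonality in terms of central characters -/

namespace SpinSupermodule

open SergeevGroup

variable {d : ℕ} {V W : Type*} [AddCommGroup V] [Module ℂ V] [FiniteDimensional ℂ V]
  [AddCommGroup W] [Module ℂ W] [FiniteDimensional ℂ W]

theorem isOddPerm_iff_mem_odds {γ : d.Partition} {g : Equiv.Perm (Fin d)}
    (hg : g.partition.parts = γ.parts) : IsOddPerm g ↔ γ ∈ Nat.Partition.odds d := by
  simp [IsOddPerm, hg, Nat.Partition.odds, Nat.Partition.restricted]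

/-- Every class of a pure permutation with odd cycles only is `C_γ` for exactly one odd `γ`. -/
theorem sum_odds_sum_conjClass (F : SergeevGroup d → ℂ) [∀ γ : d.Partition,
    DecidablePred (· ∈ conjClass γ)]
    [DecidablePred fun x : SergeevGroup d =>
      ∃ g, IsOddPerm g ∧ IsConj (SergeevGroup.pure g) x] :
    ∑ γ ∈ Nat.Partition.odds d, ∑ x with x ∈ conjClass γ, F x =
      ∑ x with ∃ g, IsOddPerm g ∧ IsConj (SergeevGroup.pure g) x, F x := by
  simp only [Finset.sum_filter]
  rw [Finset.sum_comm]
  refine Finset.sum_congr rfl fun x _ => ?_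
  split_ifs with hx
  · obtain ⟨g, hg, hgx⟩ := hx
    -- `g.partition` is a partition of `Fintype.card (Fin d)`, so its parts are repackaged as a
    -- partition of `d`.
    let γ : d.Partition :=
      ⟨g.partition.parts, g.partition.parts_pos, by rw [g.partition.parts_sum, Fintype.card_fin]⟩
    have hγ : g.partition.parts = γ.parts := rfl
    rw [Finset.sum_eq_single_of_mem γ ((isOddPerm_iff_mem_odds hγ).mp hg) fun γ' _ hne => ?_,
      if_pos ((mem_conjClass hγ).mpr hgx)]
    refine if_neg fun ⟨h, hh, hhx⟩ => hne ?_
    have hc : IsConj g h := (isConj_right hgx).trans (isConj_right hhx).symm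
    ext1
    rw [← hγ, ← hh, Equiv.Perm.partition_eq_of_isConj.mp hc]
  · refine Finset.sum_eq_zero fun γ hγ => if_neg fun ⟨g, hg, hgx⟩ => hx ⟨g, ?_, hgx⟩
    exact (isOddPerm_iff_mem_odds hg).mpr hγ

/-- `IntertwiningMap` ignores the grading, so odd intertwiners count too; this makes the parity of
`ℓ(λ)` visible in the final formula. -/
theorem sum_character_eq_card_mul (M : SpinSupermodule d V) (N : SpinSupermodule d W) :
    ∑ x, N.rho.character x * M.rho.character x⁻¹ = Fintype.card (SergeevGroup d) *
      (Module.finrank ℂ (Representation.IntertwiningMap M.rho N.rho) : ℂ) := by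
  have h0 : (Nat.card (SergeevGroup d) : ℂ) ≠ 0 := Nat.cast_ne_zero.mpr Nat.card_pos.ne'
  have := invertibleOfNonzero h0
  rw [← Representation.card_inv_mul_sum_char_mul_char_eq_finrank, ← Nat.card_eq_fintype_card,
    mul_inv_cancel_left₀ h0]

/-- For each odd `γ`, the central characters times the dimensions give `|C_γ|² χ_M χ_N`, and `ϑ_γ`
turns one factor `|C_γ|` into `|C(d)|`. The leading 2 accounts for the elements `εx` with `x ∈ C_γ`.
-/
theorem sum_vartheta_mul (M : SpinSupermodule d V) (N : SpinSupermodule d W)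
    (hM : M.IsIrreducible) (hN : N.IsIrreducible) :
    2 * (∑ γ ∈ Nat.Partition.odds d, (γ.vartheta : ℂ) * M.centralChar γ * N.centralChar γ) *
      (Module.finrank ℂ V * Module.finrank ℂ W) = (Fintype.card (SergeevGroup d) : ℂ) ^ 2 *
      (Module.finrank ℂ (Representation.IntertwiningMap M.rho N.rho) : ℂ) := by
  classical
  rw [pow_two, mul_assoc (Fintype.card (SergeevGroup d) : ℂ), ← sum_character_eq_card_mul,
    sum_character_eq, mul_assoc, mul_left_comm _ (2 : ℂ), Finset.sum_mul]
  congr 1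
  rw [← sum_odds_sum_conjClass, Finset.mul_sum]
  refine Finset.sum_congr rfl fun γ hγ => ?_
  obtain ⟨g, hg⟩ := exists_perm_partition γ
  have hodd := (isOddPerm_iff_mem_odds hg).mpr hγ
  have hsum : ∑ x with x ∈ conjClass γ, N.rho.character x * M.rho.character x⁻¹ =
      (conjClass γ).ncard *
        (N.rho.character (SergeevGroup.pure g) * M.rho.character (SergeevGroup.pure g)) := by
    have hset : (Finset.univ.filter fun x => x ∈ conjClass γ) = (conjClass γ).toFinset := by
      ext x
      simp
    rw [hset, Set.ncard_eq_toFinset_card', ← nsmul_eq_mul, ← Finset.sum_const]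
    refine Finset.sum_congr rfl fun x hx => ?_
    have hgx := (mem_conjClass hg).mp (Set.mem_toFinset.mp hx)
    rw [character_eq_of_isConj (ρ := N.rho) hgx, ← character_pure_inv (ρ := M.rho),
      character_eq_of_isConj (ρ := M.rho) (isConj_inv hgx)]
  have h1 := hM.centralChar_mul_finrank hg
  have h2 := hN.centralChar_mul_finrank hg
  have h3 : ((conjClass γ).ncard : ℂ) * γ.vartheta = Fintype.card (SergeevGroup d) := by
    exact_mod_cast ncard_conjClass_mul_vartheta hg hodd
  rw [hsum, ← h3]
  calc (γ.vartheta : ℂ) * M.centralChar γ * N.centralChar γ *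
        (Module.finrank ℂ V * Module.finrank ℂ W)
      = γ.vartheta * (M.centralChar γ * Module.finrank ℂ V) *
          (N.centralChar γ * Module.finrank ℂ W) := by ring
    _ = _ := by rw [h1, h2]; ring

end SpinSupermodule

theorem lemma1p1 (d : ℕ) {V W : Type*}
    [AddCommGroup V] [Module ℂ V] [FiniteDimensional ℂ V]
    [AddCommGroup W] [Module ℂ W] [FiniteDimensional ℂ W]
    (lam mu : d.Partition)
    (hlam : lam ∈ Nat.Partition.distincts d) (hmu : mu ∈ Nat.Partition.distincts d)
    (M : SpinSupermodule d V) (hM : M.IsIrreducibleOfIndex lam)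
    (N : SpinSupermodule d W) (hN : N.IsIrreducibleOfIndex mu) :
    ∑ γ ∈ Nat.Partition.odds d, (γ.vartheta : ℂ) * M.centralChar γ * N.centralChar γ =
      (if lam = mu then 1 else 0) /
        (if Even lam.parts.card then 2 * M.cNum ^ 2 else M.cNum ^ 2) := by
  have hMnt := hM.1.1
  have hNnt := hN.1.1
  have hV : (Module.finrank ℂ V : ℂ) ≠ 0 := Nat.cast_ne_zero.mpr Module.finrank_pos.ne'
  have hW : (Module.finrank ℂ W : ℂ) ≠ 0 := Nat.cast_ne_zero.mpr Module.finrank_pos.ne'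
  have hC : (Fintype.card (SergeevGroup d) : ℂ) ≠ 0 := Nat.cast_ne_zero.mpr Fintype.card_ne_zero
  have key := SpinSupermodule.sum_vartheta_mul M N hM.1 hN.1
  have hdim := SpinSupermodule.finrank_intertwiningMap_of_index hM hN
  rw [hdim] at key
  set S := ∑ γ ∈ Nat.Partition.odds d, (γ.vartheta : ℂ) * M.centralChar γ * N.centralChar γ
  by_cases h : lam = mu
  -- The right side involves only `dim V`; a bijective intertwiner replaces `dim W` by it.
  · have hVW : Module.finrank ℂ W = Module.finrank ℂ V := by
      have hpos : 0 < Module.finrank ℂ (Representation.IntertwiningMap M.rho N.rho) := by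
        rw [hdim, if_pos h]
        split_ifs <;> norm_num
      have := Module.nontrivial_of_finrank_pos hpos
      obtain ⟨f, hf⟩ := exists_ne (0 : Representation.IntertwiningMap M.rho N.rho)
      obtain ⟨g, -, hbij⟩ := hM.1.exists_bijective hN.1 f.isIntertwining
        fun h0 => hf (Representation.IntertwiningMap.ext h0)
      exact (LinearEquiv.ofBijective g hbij).finrank_eq.symm
    rw [if_pos h, hVW] at key
    rw [if_pos h, SpinSupermodule.cNum]
    split_ifs with he
    · rw [if_pos he] at key
      field_simp
      push_cast at key
      linear_combination key
    -- For odd `ℓ(λ)` the two-dimensional space of intertwiners cancels the factor 2 coming from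
    -- `ε`.
    · rw [if_neg he] at key
      field_simp
      push_cast at key
      linear_combination key / 2
  · rw [if_neg h, Nat.cast_zero, mul_zero] at key
    rw [if_neg h, zero_div]
    have h1 : (2 : ℂ) * S = 0 := (mul_eq_zero.mp key).resolve_right (mul_ne_zero hV hW)
    exact (mul_eq_zero.mp h1).resolve_left two_ne_zero
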